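/- Let $\Omega\subset\mathbb{R}^d$, let $s,k\ge 0$ be integers, and let $\Pi^d_s$ be the space of $d$-variate polynomials of total degree at most $s-1$ ($\Pi^d_0=\{0\}$), with basis $p_1,\dots,p_M$. Let $K:\Omega\times\Omega\to\mathbb{R}$ be a symmetric conditionally positive definite kernel of order $s$: $\sum_{i,j}c_ic_jK(y_i,y_j)>0$ for all finitely many distinct points $y_i\in\Omega$ and all coefficients $c\neq 0$ with $\sum_i c_ip(y_i)=0$ for all $p\in\Pi^d_s$. The native space $\mathcal F_K$ is the completion, as a space of functions on $\Omega$, of the space of functions $\sum_i c_iK(\cdot,y_i)+p$, with $p\in\Pi^d_s$ and $(c,y)$ subject to the same moment conditions, with respect to the seminorm $\|\cdot\|_K=\big(\sum_{i,j}c_ic_jK(y_i,y_j)\big)^{1/2}$. Let $Df=\sum_{|\alpha|\le k}a_\alpha\partial^\alpha f$ be a linear differential operator with variable coefficients. Let $z\in\Omega$, let $x_1,\dots,x_N\in\Omega$ be distinct, and for $w\in\mathbb{R}^N$ let $\varepsilon_wf=Df(z)-\sum_{j=1}^Nw_jf(x_j)$. Primes and double primes denote application of a functional or operator to the first and to the second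 argument of $K$. Assume that (a) $K$ possesses continuous partial derivatives $\partial^{\alpha,\beta}K$ at $(z,z)$ for all $|\alpha|,|\beta|\le k$, in the following sense: all partial derivatives of $K$ of positive order with at most $k$ differentiations in the first and at most $k$ in the second argument, taken in any order, exist in a neighbourhood of $(z,z)$ contained in $\Omega\times\Omega$ and are continuous at $(z,z)$ (no condition if $k=0$); (b) $D'K(z,x_i)$ exists for $i=1,\dots,N$; (c) the linear system $\sum_{j=1}^Nw_jp_i(x_j)=Dp_i(z)$, $1\le i\le M$, has a solution $w\in\mathbb{R}^N$. Then there is exactly one $w^*\in\mathbb{R}^N$ that solves this system and, together with some $v\in\mathbb{R}^M$, the equations $\sum_{j=1}^Nw^*_jK(x_i,x_j)+\sum_{j=1}^Mv_jp_j(x_i)=D'K(z,x_i)$, $1\le i\le N$. For all $f\in\mathcal F_K$, $Df(z)$ exists and $$\Big|Df(z)-\sum_{j=1}^Nw^*_jf(x_j)\Big|\le P\,\|f\|_K,$$ where the power function $P\ge 0$ is defined by $$P^2=\min\{Q(w):w\in\mathbb{R}^N,\ \varepsilon_wp=0\text{ for all }p\in\Pi^d_s\},\qquad Q(w)=\varepsilon_w'\varepsilon_w''K,$$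 and this minimum exists. Moreover, for each $w$ with $\varepsilon_w(\Pi^d_s)=0$, $$Q(w)=\sup\{|\varepsilon_wf|^2: f\in\mathcal F_K,\ \|f\|_K\le 1\},$$ and the formula with the weights $w^*$ is an optimal recovery of $Df(z)$: $\varepsilon_{w^*}(\Pi^d_s)=0$, $Q(w^*)=P^2$, and $$P=\sup_{\|f\|_K\le 1}|\varepsilon_{w^*}f|=\min_{w:\,\varepsilon_w(\Pi^d_s)=0}\ \sup_{\|f\|_K\le 1}|\varepsilon_wf|.$$ -/

import Mathlib

open Filter Topology

namespace KernelDiff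

noncomputable section

/-! ### Iterated directional and partial derivatives -/

/-- Iterated directional derivatives of `f` along the vectors of the list; the head of the list is
applied last. -/
def iterDeriv {F : Type*} [NormedAddCommGroup F] [NormedSpace ℝ F] :
    List F → (F → ℝ) → F → ℝ
  | [], f => f
  | v :: l, f => fun x => lineDeriv ℝ (iterDeriv l f) x v

/-- The iterated directional derivative along `l` of a function defined on `Ω` exists at `x`: all
inner derivatives exist near `x`, and the outermost one exists at `x`. In particular `x ∈ Ω`, and
`Ω` is a neighbourhood of `x` as soon as `l` is not empty. -/
def IterDerivExists {F : Type*} [NormedAddCommGroup F] [NormedSpace ℝ F] (Ω : Set F) :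
    List F → (F → ℝ) → F → Prop
  | [], _, x => x ∈ Ω
  | v :: l, f, x =>
      (∀ᶠ y in 𝓝 x, IterDerivExists Ω l f y) ∧ LineDifferentiableAt ℝ (iterDeriv l f) x v

/-- The `i`-th coordinate vector of `ℝ^d`. -/
def coordVec {d : ℕ} (i : Fin d) : EuclideanSpace ℝ (Fin d) := EuclideanSpace.single i 1

/-- The list of coordinate vectors along which `∂^α` differentiates. -/
def multiIndexDirs {d : ℕ} (α : Fin d → ℕ) : List (EuclideanSpace ℝ (Fin d)) :=
  (List.finRange d).flatMap fun i => List.replicate (α i) (coordVec i)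

/-- The multi-indices `α` with `|α| ≤ k`. -/
def multiIndices (d k : ℕ) : Finset (Fin d → ℕ) :=
  (Fintype.piFinset fun _ : Fin d => Finset.range (k + 1)).filter fun α => ∑ i, α i ≤ k

/-- The value `Df(z) = ∑_{|α| ≤ k} a_α(z) ∂^α f(z)` of the linear differential operator of order
`k` with variable coefficients `a_α`. -/
def diffOp {d : ℕ} (k : ℕ) (a : (Fin d → ℕ) → EuclideanSpace ℝ (Fin d) → ℝ)
    (f : EuclideanSpace ℝ (Fin d) → ℝ) (z : EuclideanSpace ℝ (Fin d)) : ℝ :=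
  ∑ α ∈ multiIndices d k, a α z * iterDeriv (multiIndexDirs α) f z

/-- `Df(z)` exists, for a function `f` on `Ω`: every derivative that really occurs in `D` at `z`
exists. -/
def DiffOpExists {d : ℕ} (Ω : Set (EuclideanSpace ℝ (Fin d))) (k : ℕ)
    (a : (Fin d → ℕ) → EuclideanSpace ℝ (Fin d) → ℝ)
    (f : EuclideanSpace ℝ (Fin d) → ℝ) (z : EuclideanSpace ℝ (Fin d)) : Prop :=
  ∀ α ∈ multiIndices d k, a α z ≠ 0 → IterDerivExists Ω (multiIndexDirs α) f z

/-- The coordinate directions of `ℝ^d × ℝ^d`: `inl i` is the `i`-th coordinate of the first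
argument, `inr j` the `j`-th coordinate of the second argument. -/
def pairVec {d : ℕ} :
    Fin d ⊕ Fin d → EuclideanSpace ℝ (Fin d) × EuclideanSpace ℝ (Fin d)
  | Sum.inl i => (coordVec i, 0)
  | Sum.inr j => (0, coordVec j)

/-- The kernel `K` on `Ω × Ω` possesses, at `(z, z)`, continuous partial derivatives
`∂^{α,β} K` for all `|α|, |β| ≤ k`: each partial derivative of positive order with at most `k`
differentiations in the first and at most `k` in the second argument, taken in any order, exists in
a neighbourhood of `(z, z)` and is continuous at `(z, z)`. (No condition if `k = 0`.) -/
def HasMixedPartials {d : ℕ} (Ω : Set (EuclideanSpace ℝ (Fin d))) (k : ℕ)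
    (K : EuclideanSpace ℝ (Fin d) → EuclideanSpace ℝ (Fin d) → ℝ)
    (z : EuclideanSpace ℝ (Fin d)) : Prop :=
  ∀ l : List (Fin d ⊕ Fin d), l ≠ [] →
    l.countP (fun i => i.isLeft) ≤ k → l.countP (fun i => i.isRight) ≤ k →
      (∀ᶠ q in 𝓝 (z, z),
        IterDerivExists (Ω ×ˢ Ω) (l.map pairVec) (fun r => K r.1 r.2) q) ∧
      ContinuousAt (iterDeriv (l.map pairVec) (fun r => K r.1 r.2)) (z, z)

/-! ### Polynomials and conditionally positive definite kernels -/

/-- `Π^d_s`: the polynomials in `d` variables of total degree at most `s - 1`, and `{0}` if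
`s = 0`. -/
def polySpace (d s : ℕ) : Submodule ℝ (MvPolynomial (Fin d) ℝ) :=
  MvPolynomial.restrictSupport ℝ {n : Fin d →₀ ℕ | n.degree < s}

/-- A polynomial as a function on `ℝ^d`. -/
def polyFun {d : ℕ} (p : MvPolynomial (Fin d) ℝ) (x : EuclideanSpace ℝ (Fin d)) : ℝ :=
  MvPolynomial.eval (fun i => x i) p

/-- `IsAnnihilator Ω s c`: the functional `f ↦ ∑ c_x f(x)` is supported on finitely many points of
`Ω` and vanishes on `Π^d_s`. -/
def IsAnnihilator {d : ℕ} (Ω : Set (EuclideanSpace ℝ (Fin d))) (s : ℕ)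
    (c : EuclideanSpace ℝ (Fin d) →₀ ℝ) : Prop :=
  (∀ x ∈ c.support, x ∈ Ω) ∧ ∀ p ∈ polySpace d s, (c.sum fun x b => b * polyFun p x) = 0

/-- The quadratic form `∑_{x,y} c_x c_y K(x, y)`. -/
def energy {d : ℕ} (K : EuclideanSpace ℝ (Fin d) → EuclideanSpace ℝ (Fin d) → ℝ)
    (c : EuclideanSpace ℝ (Fin d) →₀ ℝ) : ℝ :=
  c.sum fun x b => c.sum fun y b' => b * b' * K x y

/-- `K` is a symmetric conditionally positive definite kernel of order `s` on `Ω` (strictly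
positive definite for `s = 0`). -/
def IsCPD {d : ℕ} (Ω : Set (EuclideanSpace ℝ (Fin d))) (s : ℕ)
    (K : EuclideanSpace ℝ (Fin d) → EuclideanSpace ℝ (Fin d) → ℝ) : Prop :=
  (∀ x ∈ Ω, ∀ y ∈ Ω, K x y = K y x) ∧
    ∀ c : EuclideanSpace ℝ (Fin d) →₀ ℝ, IsAnnihilator Ω s c → c ≠ 0 → 0 < energy K c

/-! ### The native space -/

/-- The function `∑_x c_x K(·, x) + p`. -/
def kernelSum {d : ℕ} (K : EuclideanSpace ℝ (Fin d) → EuclideanSpace ℝ (Fin d) → ℝ)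
    (c : EuclideanSpace ℝ (Fin d) →₀ ℝ) (p : MvPolynomial (Fin d) ℝ)
    (y : EuclideanSpace ℝ (Fin d)) : ℝ :=
  (c.sum fun x b => b * K y x) + polyFun p y

/-- `f`, as a function on `Ω`, belongs to the completion of the space of functions
`∑_x c_x K(·, x) + p`, with `p ∈ Π^d_s` and `c` annihilating `Π^d_s`, with respect to the seminorm
`(∑ c_x c_y K(x, y))^{1/2}`, and `r` is its seminorm: `f` is the pointwise limit on `Ω` of a Cauchy
sequence of such functions, whose seminorms tend to `r`. -/
def HasNativeNorm {d : ℕ} (Ω : Set (EuclideanSpace ℝ (Fin d))) (s : ℕ)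
    (K : EuclideanSpace ℝ (Fin d) → EuclideanSpace ℝ (Fin d) → ℝ)
    (f : EuclideanSpace ℝ (Fin d) → ℝ) (r : ℝ) : Prop :=
  ∃ (c : ℕ → EuclideanSpace ℝ (Fin d) →₀ ℝ) (p : ℕ → MvPolynomial (Fin d) ℝ),
    (∀ n, IsAnnihilator Ω s (c n)) ∧ (∀ n, p n ∈ polySpace d s) ∧
    (∀ ε > 0, ∃ n₀, ∀ m ≥ n₀, ∀ n ≥ n₀, √(energy K (c m - c n)) < ε) ∧
    (∀ y ∈ Ω, Tendsto (fun n => kernelSum K (c n) (p n) y) atTop (𝓝 (f y))) ∧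
    Tendsto (fun n => √(energy K (c n))) atTop (𝓝 r)

/-- The native space of `K` (functions on `ℝ^d` of which only the restriction to `Ω` matters). -/
def nativeSpace {d : ℕ} (Ω : Set (EuclideanSpace ℝ (Fin d))) (s : ℕ)
    (K : EuclideanSpace ℝ (Fin d) → EuclideanSpace ℝ (Fin d) → ℝ) :
    Set (EuclideanSpace ℝ (Fin d) → ℝ) :=
  {f | ∃ r, HasNativeNorm Ω s K f r}

/-- The seminorm of the native space: the number `r` with `HasNativeNorm Ω s K f r`, which does not
depend on the approximating sequence. -/
def nativeNorm {d : ℕ} (Ω : Set (EuclideanSpace ℝ (Fin d))) (s : ℕ)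
    (K : EuclideanSpace ℝ (Fin d) → EuclideanSpace ℝ (Fin d) → ℝ)
    (f : EuclideanSpace ℝ (Fin d) → ℝ) : ℝ :=
  sInf {r | HasNativeNorm Ω s K f r}

/-! ### Numerical differentiation formulas -/

/-- The error functional `ε_w f = Df(z) - ∑_j w_j f(x_j)`. -/
def errFun {d N : ℕ} (k : ℕ) (a : (Fin d → ℕ) → EuclideanSpace ℝ (Fin d) → ℝ)
    (z : EuclideanSpace ℝ (Fin d)) (x : Fin N → EuclideanSpace ℝ (Fin d)) (w : Fin N → ℝ)
    (f : EuclideanSpace ℝ (Fin d) → ℝ) : ℝ :=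
  diffOp k a f z - ∑ j, w j * f (x j)

/-- The formula with weights `w` is exact for the polynomials in `Π^d_s`. -/
def IsExact {d N : ℕ} (s k : ℕ) (a : (Fin d → ℕ) → EuclideanSpace ℝ (Fin d) → ℝ)
    (z : EuclideanSpace ℝ (Fin d)) (x : Fin N → EuclideanSpace ℝ (Fin d))
    (w : Fin N → ℝ) : Prop :=
  ∀ p ∈ polySpace d s, errFun k a z x w (polyFun p) = 0

/-- `Q(w) = ε_w' ε_w'' K`: the functional `ε_w` is applied to the second argument of `K`, and then
to the first. -/
def Qform {d N : ℕ} (K : EuclideanSpace ℝ (Fin d) → EuclideanSpace ℝ (Fin d) → ℝ) (k : ℕ)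
    (a : (Fin d → ℕ) → EuclideanSpace ℝ (Fin d) → ℝ) (z : EuclideanSpace ℝ (Fin d))
    (x : Fin N → EuclideanSpace ℝ (Fin d)) (w : Fin N → ℝ) : ℝ :=
  errFun k a z x w fun ξ => errFun k a z x w fun η => K ξ η

/-- The power function: the nonnegative number whose square is the minimum of `Q` over the weights
that are exact on `Π^d_s`. -/
def powerFun {d N : ℕ} (s : ℕ) (K : EuclideanSpace ℝ (Fin d) → EuclideanSpace ℝ (Fin d) → ℝ)
    (k : ℕ) (a : (Fin d → ℕ) → EuclideanSpace ℝ (Fin d) → ℝ) (z : EuclideanSpace ℝ (Fin d))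
    (x : Fin N → EuclideanSpace ℝ (Fin d)) : ℝ :=
  √(sInf {t | ∃ w : Fin N → ℝ, IsExact s k a z x w ∧ t = Qform K k a z x w})

/-- The first block of equations, `∑_j w_j K(x_i, x_j) + ∑_j v_j p_j(x_i) = D'K(z, x_i)`. -/
def KernelEqs {d N M : ℕ} (K : EuclideanSpace ℝ (Fin d) → EuclideanSpace ℝ (Fin d) → ℝ) (k : ℕ)
    (a : (Fin d → ℕ) → EuclideanSpace ℝ (Fin d) → ℝ) (z : EuclideanSpace ℝ (Fin d))
    (x : Fin N → EuclideanSpace ℝ (Fin d)) (p : Fin M → MvPolynomial (Fin d) ℝ)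
    (w : Fin N → ℝ) (v : Fin M → ℝ) : Prop :=
  ∀ i, ∑ j, w j * K (x i) (x j) + ∑ j, v j * polyFun (p j) (x i)
    = diffOp k a (fun y => K y (x i)) z

/-- The second block of equations, `∑_j w_j p_i(x_j) = D p_i(z)`. -/
def PolyEqs {d N M : ℕ} (k : ℕ) (a : (Fin d → ℕ) → EuclideanSpace ℝ (Fin d) → ℝ)
    (z : EuclideanSpace ℝ (Fin d)) (x : Fin N → EuclideanSpace ℝ (Fin d))
    (p : Fin M → MvPolynomial (Fin d) ℝ) (w : Fin N → ℝ) : Prop :=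
  ∀ i, ∑ j, w j * polyFun (p i) (x j) = diffOp k a (polyFun (p i)) z

/-- The absolute errors of the formula with weights `w` on the unit ball of the native space. -/
def unitBallErrors {d N : ℕ} (Ω : Set (EuclideanSpace ℝ (Fin d))) (s : ℕ)
    (K : EuclideanSpace ℝ (Fin d) → EuclideanSpace ℝ (Fin d) → ℝ) (k : ℕ)
    (a : (Fin d → ℕ) → EuclideanSpace ℝ (Fin d) → ℝ) (z : EuclideanSpace ℝ (Fin d))
    (x : Fin N → EuclideanSpace ℝ (Fin d)) (w : Fin N → ℝ) : Set ℝ :=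
  {e | ∃ f ∈ nativeSpace Ω s K, nativeNorm Ω s K f ≤ 1 ∧ e = |errFun k a z x w f|}

end

end KernelDiff

namespace KernelDiff

/-! ### Iterated derivatives -/

section IterDeriv

variable {F : Type*} [NormedAddCommGroup F] [NormedSpace ℝ F]

/-! The kernel form is an inner product on the finitely supported functionals that annihilate
`Π^d_s`. Let `H` be the completion and `J` the map of functionals into it. A native function `f`
then corresponds to a vector `u` with `‖u‖ = ‖f‖_K` and `c(f) = ⟪J c, u⟫` for every annihilating `c`
(`IsFeatureMap.exists_of_mem_nativeSpace`). Everything reduces to Hilbert space geometry once the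
error functional of each exact formula is represented by a vector `e w`.

Point evaluations need not annihilate `Π^d_s`, so they are corrected to `λ_ξ = δ_ξ - ∑ p_j(ξ)
δ_{y_j}`, with finitely many `y_j` close to `z` reproducing `Π^d_s`. On that neighbourhood `f(ξ) =
⟪J λ_ξ, u⟫ + ∑ f(y_j) p_j(ξ)`, and the analytic point is that `D` may be applied to the first term.
The squared norm of a difference quotient of `ξ ↦ J λ_ξ` is a mixed second difference quotient of
the kernel `⟪J λ_ξ, J λ_η⟫`, hence bounded; the quotients converge when tested against the vectors
`J λ_η`, hence weakly (`exists_weak_limit`). The kernel of the weak derivative is a mixed derivative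
of the old kernel, so the argument iterates (`exists_weak_partial`, `exists_weak_iterDeriv`).

This gives `ε_w f = ⟪e w, u⟫`, `Q(w) = ‖e w‖²`, and by density of the kernel sums the worst case
error `‖e w‖` (`exists_error_representer`, `IsFeatureMap.isLUB_unitBallErrors`). The vectors `e w`,
for `w` exact, fill an affine subspace of finite dimension. Its point of least norm is given by
orthogonal projection, and the orthogonality conditions, with Lagrange multipliers `v` for
exactness, are the kernel equations. Strict positivity at distinct nodes makes the weights unique.
-/

theorem hasLineDerivAt_const (c : ℝ) (x v : F) : HasLineDerivAt ℝ (fun _ => c) 0 x v :=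
  hasDerivAt_const (0 : ℝ) c

theorem iterDeriv_append_singleton (l : List F) (v : F) (f : F → ℝ) :
    iterDeriv (l ++ [v]) f = iterDeriv l (fun x => lineDeriv ℝ f x v) := by
  induction l with
  | nil => rfl
  | cons u l ih => simp only [List.cons_append, iterDeriv, ih]

theorem iterDeriv_congr {f g : F → ℝ} {x : F} (h : f =ᶠ[𝓝 x] g) (l : List F) :
    iterDeriv l f =ᶠ[𝓝 x] iterDeriv l g := by
  induction l with
  | nil => exact h
  | cons v l ih =>
    filter_upwards [ih.eventuallyEq_nhds] with y hy
    exact hy.lineDeriv_eq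

theorem IterDerivExists.congr {Ω : Set F} {f g : F → ℝ} {l : List F} {x : F}
    (hf : IterDerivExists Ω l f x) (h : f =ᶠ[𝓝 x] g) : IterDerivExists Ω l g x := by
  induction l generalizing x with
  | nil => exact hf
  | cons v l ih =>
    refine ⟨?_, hf.2.congr_of_eventuallyEq (iterDeriv_congr h l).symm⟩
    filter_upwards [hf.1, h.eventuallyEq_nhds] with y hy hy'
    exact ih hy hy'

theorem IterDerivExists.lin {Ω : Set F} {f g : F → ℝ} {l : List F} {x : F} (b c : ℝ)
    (hf : IterDerivExists Ω l f x) (hg : IterDerivExists Ω l g x) :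
    IterDerivExists Ω l (fun y => b * f y + c * g y) x ∧
      iterDeriv l (fun y => b * f y + c * g y) x = b * iterDeriv l f x + c * iterDeriv l g x := by
  induction l generalizing x with
  | nil => exact ⟨hf, rfl⟩
  | cons v l ih =>
    have h1 : ∀ᶠ y in 𝓝 x, IterDerivExists Ω l (fun y => b * f y + c * g y) y ∧
        iterDeriv l (fun y => b * f y + c * g y) y = b * iterDeriv l f y + c * iterDeriv l g y := by
      filter_upwards [hf.1, hg.1] with y h1 h2 using ih h1 h2
    have h2 : iterDeriv l (fun y => b * f y + c * g y) =ᶠ[𝓝 x]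
        fun y => b * iterDeriv l f y + c * iterDeriv l g y := h1.mono fun y hy => hy.2
    have h3 : HasLineDerivAt ℝ (fun y => b * iterDeriv l f y + c * iterDeriv l g y)
        (b * iterDeriv (v :: l) f x + c * iterDeriv (v :: l) g x) x v := by
      have hf' : HasDerivAt _ _ (0 : ℝ) := hf.2.hasLineDerivAt
      have hg' : HasDerivAt _ _ (0 : ℝ) := hg.2.hasLineDerivAt
      exact (hf'.const_mul b).add (hg'.const_mul c)
    have h4 := h3.congr_of_eventuallyEq h2
    exact ⟨⟨h1.mono fun y hy => hy.1, h4.lineDifferentiableAt⟩, h4.lineDeriv⟩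

theorem iterDerivExists_zero {Ω : Set F} {l : List F} {x : F} (hx : x ∈ Ω)
    (h : l = [] ∨ Ω ∈ 𝓝 x) :
    IterDerivExists Ω l (fun _ => 0) x ∧ iterDeriv l (fun _ : F => (0 : ℝ)) x = 0 := by
  have h0 : ∀ l : List F, iterDeriv l (fun _ : F => (0 : ℝ)) = fun _ => 0 := by
    intro l
    induction l with
    | nil => rfl
    | cons v l ih => funext y; simp only [iterDeriv, ih]; exact (hasLineDerivAt_const 0 y v).lineDeriv
  refine ⟨?_, by rw [h0]⟩
  rcases h with rfl | h
  · exact hx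
  · clear hx
    induction l generalizing x with
    | nil => exact mem_of_mem_nhds h
    | cons v l ih =>
      refine ⟨?_, ?_⟩
      · filter_upwards [eventually_mem_nhds_iff.2 h] with y hy using ih hy
      · rw [h0]; exact (hasLineDerivAt_const _ _ _).lineDifferentiableAt

/-- The definition peels off the outermost derivative, whereas the weak derivatives are built from
the innermost one. An open set is used because each inner derivative has to exist near every point
at which the next one is taken. -/
theorem IterDerivExists.append_singleton {Ω U : Set F} (hU : IsOpen U) {l : List F} {v : F}
    {f : F → ℝ} (hUΩ : U ⊆ Ω) (hf : ∀ x ∈ U, LineDifferentiableAt ℝ f x v)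
    (h : ∀ x ∈ U, IterDerivExists Ω l (fun x => lineDeriv ℝ f x v) x) :
    ∀ x ∈ U, IterDerivExists Ω (l ++ [v]) f x := by
  induction l with
  | nil =>
    intro x hx
    exact ⟨mem_of_superset (hU.mem_nhds hx) hUΩ, hf x hx⟩
  | cons u l ih =>
    intro x hx
    refine ⟨?_, ?_⟩
    · filter_upwards [hU.mem_nhds hx] with y hy
      refine ih (fun y hy => ?_) y hy
      exact ((h y hy).1).self_of_nhds
    · have := (h x hx).2
      rwa [← iterDeriv_append_singleton] at this

end IterDeriv

/-! ### Differential operators -/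

section DiffOp

variable {d : ℕ}

theorem multiIndexDirs_eq (α : Fin d → ℕ) :
    ∃ l : List (Fin d), multiIndexDirs α = l.map coordVec ∧ l.length = ∑ i, α i := by
  refine ⟨(List.finRange d).flatMap fun i => List.replicate (α i) i, ?_, ?_⟩
  · simp [multiIndexDirs, List.map_flatMap]
  · simp [List.length_flatMap, Fin.sum_univ_def]

theorem exists_list_of_mem_multiIndices {k : ℕ} {α : Fin d → ℕ} (hα : α ∈ multiIndices d k) :
    ∃ l : List (Fin d), multiIndexDirs α = l.map coordVec ∧ l.length ≤ k := by
  obtain ⟨l, h1, h2⟩ := multiIndexDirs_eq α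
  exact ⟨l, h1, h2.trans_le (Finset.mem_filter.1 hα).2⟩

/-- For `k = 0` only the value at `z` enters and `Ω` need not be a neighbourhood of `z`. This
dichotomy lets both cases share the later arguments. -/
theorem multiIndexDirs_eq_nil_or {k : ℕ} {α : Fin d → ℕ} (hα : α ∈ multiIndices d k)
    {p : Prop} (h : k = 0 ∨ p) : multiIndexDirs α = [] ∨ p := by
  rcases h with rfl | h
  · obtain ⟨l, h1, h2⟩ := exists_list_of_mem_multiIndices hα
    left
    rw [h1, List.eq_nil_of_length_eq_zero (Nat.le_zero.1 h2), List.map_nil]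
  · exact Or.inr h

variable {Ω Y : Set (EuclideanSpace ℝ (Fin d))} {k : ℕ}
  {a : (Fin d → ℕ) → EuclideanSpace ℝ (Fin d) → ℝ} {f g : EuclideanSpace ℝ (Fin d) → ℝ}
  {z : EuclideanSpace ℝ (Fin d)}

theorem diffOp_congr (hz : z ∈ Y) (hY : k = 0 ∨ Y ∈ 𝓝 z) (h : ∀ y ∈ Y, f y = g y) :
    diffOp k a f z = diffOp k a g z := by
  refine Finset.sum_congr rfl fun α hα => ?_
  rcases multiIndexDirs_eq_nil_or hα hY with h0 | h0
  · simp only [h0, iterDeriv, h z hz]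
  · have : f =ᶠ[𝓝 z] g := by filter_upwards [h0] with y hy using h y hy
    rw [(iterDeriv_congr this _).self_of_nhds]

theorem DiffOpExists.congr (hf : DiffOpExists Ω k a f z) (hz : z ∈ Ω)
    (hY : k = 0 ∨ Y ∈ 𝓝 z) (h : ∀ y ∈ Y, f y = g y) : DiffOpExists Ω k a g z := by
  intro α hα ha
  rcases multiIndexDirs_eq_nil_or hα hY with h0 | h0
  · rw [h0]; exact hz
  · refine (hf α hα ha).congr ?_
    filter_upwards [h0] with y hy using h y hy

theorem DiffOpExists.lin (b c : ℝ) (hf : DiffOpExists Ω k a f z) (hg : DiffOpExists Ω k a g z) :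
    DiffOpExists Ω k a (fun y => b * f y + c * g y) z ∧
      diffOp k a (fun y => b * f y + c * g y) z = b * diffOp k a f z + c * diffOp k a g z := by
  refine ⟨fun α hα ha => ((hf α hα ha).lin b c (hg α hα ha)).1, ?_⟩
  simp only [diffOp, Finset.mul_sum, ← Finset.sum_add_distrib]
  refine Finset.sum_congr rfl fun α hα => ?_
  -- A derivative with vanishing coefficient need not exist, but it contributes zero on both sides.
  by_cases ha : a α z = 0
  · simp [ha]
  · rw [((hf α hα ha).lin b c (hg α hα ha)).2]; ring

theorem diffOpExists_zero (hz : z ∈ Ω) (h : k = 0 ∨ Ω ∈ 𝓝 z) :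
    DiffOpExists Ω k a (fun _ => 0) z ∧ diffOp k a (fun _ => 0) z = 0 := by
  have := fun α (hα : α ∈ multiIndices d k) =>
    iterDerivExists_zero hz (multiIndexDirs_eq_nil_or hα h)
  refine ⟨fun α hα _ => (this α hα).1, ?_⟩
  exact Finset.sum_eq_zero fun α hα => by rw [(this α hα).2, mul_zero]

theorem diffOpExists_sum (hz : z ∈ Ω) (h : k = 0 ∨ Ω ∈ 𝓝 z) {ι : Type*} (t : Finset ι)
    (b : ι → ℝ) {f : ι → EuclideanSpace ℝ (Fin d) → ℝ}
    (hf : ∀ i ∈ t, DiffOpExists Ω k a (f i) z) :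
    DiffOpExists Ω k a (fun y => ∑ i ∈ t, b i * f i y) z ∧
      diffOp k a (fun y => ∑ i ∈ t, b i * f i y) z = ∑ i ∈ t, b i * diffOp k a (f i) z := by
  classical
  induction t using Finset.induction_on with
  | empty => simpa using diffOpExists_zero hz h
  | insert i t hi ih =>
    obtain ⟨h1, h2⟩ := ih fun j hj => hf j (Finset.mem_insert_of_mem hj)
    have := (hf i (Finset.mem_insert_self i t)).lin (b i) 1 h1
    simpa only [Finset.sum_insert hi, one_mul, h2] using this

end DiffOp

/-! ### Polynomials -/

section Poly

variable {d : ℕ}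

theorem hasLineDerivAt_polyFun (p : MvPolynomial (Fin d) ℝ) (x : EuclideanSpace ℝ (Fin d))
    (i : Fin d) :
    HasLineDerivAt ℝ (polyFun p) (polyFun (MvPolynomial.pderiv i p) x) x (coordVec i) := by
  unfold HasLineDerivAt
  induction p using MvPolynomial.induction_on with
  | C c => simpa [polyFun] using hasDerivAt_const (0 : ℝ) c
  | add p q hp hq =>
    simp only [polyFun, map_add] at *
    exact hp.add hq
  | mul_X p j hp =>
    have h2 : HasDerivAt (fun t : ℝ => x j + t * coordVec i j) (coordVec i j) 0 := by
      simpa using ((hasDerivAt_id (0 : ℝ)).mul_const (coordVec i j)).const_add (x j)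
    have h3 : (fun t : ℝ => polyFun (p * MvPolynomial.X j) (x + t • coordVec i))
        = fun t => polyFun p (x + t • coordVec i) * (x j + t * coordVec i j) := by
      funext t; simp [polyFun]
    rw [h3]
    refine (hp.mul h2).congr_deriv ?_
    by_cases hij : j = i
    · subst hij; simp [polyFun, coordVec]; ring
    · simp [polyFun, coordVec, hij, MvPolynomial.pderiv_X_of_ne hij]; ring

theorem iterDeriv_polyFun (l : List (Fin d)) (p : MvPolynomial (Fin d) ℝ) :
    ∃ q : MvPolynomial (Fin d) ℝ, iterDeriv (l.map coordVec) (polyFun p) = polyFun q := by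
  induction l with
  | nil => exact ⟨p, rfl⟩
  | cons i l ih =>
    obtain ⟨q, hq⟩ := ih
    refine ⟨MvPolynomial.pderiv i q, ?_⟩
    funext y
    simp only [List.map_cons, iterDeriv, hq]
    exact (hasLineDerivAt_polyFun q y i).lineDeriv

theorem iterDerivExists_polyFun {Ω : Set (EuclideanSpace ℝ (Fin d))}
    {z : EuclideanSpace ℝ (Fin d)} (hΩ : Ω ∈ 𝓝 z) (l : List (Fin d))
    (p : MvPolynomial (Fin d) ℝ) : IterDerivExists Ω (l.map coordVec) (polyFun p) z := by
  induction l generalizing z with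
  | nil => exact mem_of_mem_nhds hΩ
  | cons i l ih =>
    refine ⟨?_, ?_⟩
    · filter_upwards [eventually_mem_nhds_iff.2 hΩ] with y hy using ih hy
    · obtain ⟨q, hq⟩ := iterDeriv_polyFun l p
      rw [hq]
      exact (hasLineDerivAt_polyFun q z i).lineDifferentiableAt

theorem diffOpExists_polyFun {Ω : Set (EuclideanSpace ℝ (Fin d))}
    {z : EuclideanSpace ℝ (Fin d)} (hz : z ∈ Ω) {k : ℕ} (h : k = 0 ∨ Ω ∈ 𝓝 z)
    {a : (Fin d → ℕ) → EuclideanSpace ℝ (Fin d) → ℝ}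
    (p : MvPolynomial (Fin d) ℝ) : DiffOpExists Ω k a (polyFun p) z := by
  intro α hα _
  rcases multiIndexDirs_eq_nil_or hα h with h0 | h0
  · rw [h0]; exact hz
  · obtain ⟨l, hl, -⟩ := exists_list_of_mem_multiIndices hα
    rw [hl]
    exact iterDerivExists_polyFun h0 l p

theorem continuous_polyFun (p : MvPolynomial (Fin d) ℝ) : Continuous (polyFun p) := by
  have := MvPolynomial.continuous_eval p
  exact this.comp (continuous_pi fun i => by fun_prop)

end Poly

/-! ### Functions and kernels with bounded derivatives -/

section Bounded

variable {d : ℕ}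

/-- All partial derivatives of `f` of order at most `n` exist on `U`, and those of positive order
are bounded there. -/
def BddPartialsOn (U : Set (EuclideanSpace ℝ (Fin d))) :
    ℕ → (EuclideanSpace ℝ (Fin d) → ℝ) → Prop
  | 0, _ => True
  | n + 1, f => ∀ i, ∃ f' : EuclideanSpace ℝ (Fin d) → ℝ,
      (∀ x ∈ U, HasLineDerivAt ℝ f (f' x) x (coordVec i)) ∧ (∃ C, ∀ x ∈ U, |f' x| ≤ C) ∧
        BddPartialsOn U n f'

/-- The derivatives obtained by applying at most `n` operators `∂ᵢ''∂ᵢ'` to the kernel `g` exist on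
`U × U` and those of positive order are bounded there. -/
def BddMixedOn (U : Set (EuclideanSpace ℝ (Fin d))) :
    ℕ → (EuclideanSpace ℝ (Fin d) → EuclideanSpace ℝ (Fin d) → ℝ) → Prop
  | 0, _ => True
  | n + 1, g => ∀ i, ∃ g' g'' : EuclideanSpace ℝ (Fin d) → EuclideanSpace ℝ (Fin d) → ℝ,
      (∀ x ∈ U, ∀ y ∈ U, HasLineDerivAt ℝ (fun ξ => g ξ y) (g' x y) x (coordVec i)) ∧
      (∀ x ∈ U, ∀ y ∈ U, HasLineDerivAt ℝ (fun η => g' x η) (g'' x y) y (coordVec i)) ∧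
      (∃ C, ∀ x ∈ U, ∀ y ∈ U, |g'' x y| ≤ C) ∧ BddMixedOn U n g''

variable {U : Set (EuclideanSpace ℝ (Fin d))}

/-- Only the first differentiation sees the kernel itself, so the same `g'` and `g''` serve for `h`.
-/
theorem BddMixedOn.congr (hU : IsOpen U) {n : ℕ}
    {g h : EuclideanSpace ℝ (Fin d) → EuclideanSpace ℝ (Fin d) → ℝ} (hg : BddMixedOn U n g)
    (hgh : ∀ x ∈ U, ∀ y ∈ U, g x y = h x y) : BddMixedOn U n h := by
  cases n with
  | zero => trivial
  | succ n =>
    intro i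
    obtain ⟨g', g'', h1, h2, h3, h4⟩ := hg i
    refine ⟨g', g'', fun x hx y hy => ?_, h2, h3, h4⟩
    refine (h1 x hx y hy).congr_of_eventuallyEq ?_
    filter_upwards [hU.mem_nhds hx] with ξ hξ using (hgh ξ hξ y hy).symm

theorem BddMixedOn.add {n : ℕ}
    {g h : EuclideanSpace ℝ (Fin d) → EuclideanSpace ℝ (Fin d) → ℝ} (hg : BddMixedOn U n g)
    (hh : BddMixedOn U n h) : BddMixedOn U n (fun x y => g x y + h x y) := by
  induction n generalizing g h with
  | zero => trivial
  | succ n ih =>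
    intro i
    obtain ⟨g', g'', h1, h2, ⟨C, h3⟩, h4⟩ := hg i
    obtain ⟨k', k'', k1, k2, ⟨D, k3⟩, k4⟩ := hh i
    refine ⟨fun x y => g' x y + k' x y, fun x y => g'' x y + k'' x y, ?_, ?_, ⟨C + D, ?_⟩, ih h4 k4⟩
    · exact fun x hx y hy => HasDerivAt.add (h1 x hx y hy) (k1 x hx y hy)
    · exact fun x hx y hy => HasDerivAt.add (h2 x hx y hy) (k2 x hx y hy)
    · exact fun x hx y hy => (abs_add_le _ _).trans (add_le_add (h3 x hx y hy) (k3 x hx y hy))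

theorem BddPartialsOn.prod {n : ℕ} {f g : EuclideanSpace ℝ (Fin d) → ℝ} (hf : BddPartialsOn U n f)
    (hg : BddPartialsOn U n g) (c : ℝ) : BddMixedOn U n (fun x y => c * (f x * g y)) := by
  induction n generalizing f g with
  | zero => trivial
  | succ n ih =>
    intro i
    obtain ⟨f', h1, ⟨C, h3⟩, h4⟩ := hf i
    obtain ⟨g', k1, ⟨D, k3⟩, k4⟩ := hg i
    refine ⟨fun x y => c * (f' x * g y), fun x y => c * (f' x * g' y), ?_, ?_,
      ⟨|c| * (C * D), ?_⟩, ih h4 k4⟩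
    · exact fun x hx y hy => HasDerivAt.const_mul c (HasDerivAt.mul_const (h1 x hx) (g y))
    · exact fun x hx y hy => HasDerivAt.const_mul c (HasDerivAt.const_mul (f' x) (k1 y hy))
    · intro x hx y hy
      rw [abs_mul, abs_mul]
      have := (abs_nonneg _).trans (h3 x hx)
      gcongr
      exacts [h3 x hx, k3 y hy]

theorem BddMixedOn.zero (n : ℕ) : BddMixedOn U n (fun _ _ => 0) := by
  induction n with
  | zero => trivial
  | succ n ih =>
    exact fun i => ⟨fun _ _ => 0, fun _ _ => 0, fun _ _ _ _ => hasLineDerivAt_const _ _ _,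
      fun _ _ _ _ => hasLineDerivAt_const _ _ _, ⟨0, by simp⟩, ih⟩

theorem BddMixedOn.sum {n : ℕ} {ι : Type*} (t : Finset ι)
    {g : ι → EuclideanSpace ℝ (Fin d) → EuclideanSpace ℝ (Fin d) → ℝ}
    (hg : ∀ i, BddMixedOn U n (g i)) : BddMixedOn U n (fun x y => ∑ i ∈ t, g i x y) := by
  classical
  induction t using Finset.induction_on with
  | empty => simpa using BddMixedOn.zero n
  | insert i t hi ih => simpa only [Finset.sum_insert hi] using (hg i).add ih

theorem bddPartialsOn_polyFun (hU : Bornology.IsBounded U) (n : ℕ)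
    (p : MvPolynomial (Fin d) ℝ) : BddPartialsOn U n (polyFun p) := by
  induction n generalizing p with
  | zero => trivial
  | succ n ih =>
    refine fun i => ⟨polyFun (MvPolynomial.pderiv i p), fun x _ => hasLineDerivAt_polyFun p x i,
      ?_, ih _⟩
    obtain ⟨C, hC⟩ := hU.isCompact_closure.exists_bound_of_continuousOn
      (continuous_polyFun (MvPolynomial.pderiv i p)).continuousOn
    exact ⟨C, fun x hx => hC x (subset_closure hx)⟩

end Bounded

/-! ### Consequences of the smoothness hypothesis on the kernel -/

section Hypothesis

variable {d k : ℕ} {Ω : Set (EuclideanSpace ℝ (Fin d))}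
  {K : EuclideanSpace ℝ (Fin d) → EuclideanSpace ℝ (Fin d) → ℝ} {z : EuclideanSpace ℝ (Fin d)}

/-- On `U ⊆ Ω` all partial derivatives of `K` with at most `k` differentiations in each argument
exist, and those of positive order are bounded. -/
structure PartialsBddOn (Ω U : Set (EuclideanSpace ℝ (Fin d))) (k : ℕ)
    (K : EuclideanSpace ℝ (Fin d) → EuclideanSpace ℝ (Fin d) → ℝ) : Prop where
  isOpen : IsOpen U
  convex : Convex ℝ U
  bounded : Bornology.IsBounded U
  subset : U ⊆ Ω
  iterExists : ∀ l : List (Fin d ⊕ Fin d), l ≠ [] →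
    l.countP (fun i => i.isLeft) ≤ k → l.countP (fun i => i.isRight) ≤ k →
      ∀ x ∈ U, ∀ y ∈ U, IterDerivExists (Ω ×ˢ Ω) (l.map pairVec) (fun r => K r.1 r.2) (x, y)
  iterBdd : ∀ l : List (Fin d ⊕ Fin d), l ≠ [] →
    l.countP (fun i => i.isLeft) ≤ k → l.countP (fun i => i.isRight) ≤ k →
      ∃ C, ∀ x ∈ U, ∀ y ∈ U, |iterDeriv (l.map pairVec) (fun r => K r.1 r.2) (x, y)| ≤ C

theorem HasMixedPartials.mem_nhds (ha : HasMixedPartials Ω k K z) (hz : z ∈ Ω) (hk : k ≠ 0) :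
    Ω ∈ 𝓝 z := by
  -- For `d = 0` the hypothesis is void, but the space is a single point. Otherwise the existence of
  -- one first derivative at `(z, z)` already forces `Ω × Ω` to be a neighbourhood.
  rcases isEmpty_or_nonempty (Fin d) with h | ⟨⟨i⟩⟩
  · exact mem_of_superset univ_mem fun y _ => by rwa [Subsingleton.elim y z]
  · have h1 := (ha [Sum.inl i] (by simp) (by simp [List.countP_cons]; omega) (by simp)).1.self_of_nhds.1
    have h2 : Tendsto (fun x => (x, z)) (𝓝 z) (𝓝 (z, z)) :=
      (Continuous.prodMk_left z).tendsto z
    filter_upwards [h2.eventually h1] with x hx using hx.1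

/-- At most `2k` differentiations in all leave finitely many lists of directions, so one ball serves
for all of them; continuity at `(z, z)` bounds each derivative by its absolute value there plus one.
-/
theorem HasMixedPartials.exists_partialsBddOn (ha : HasMixedPartials Ω k K z) (hz : z ∈ Ω)
    (hk : k ≠ 0) : ∃ U, z ∈ U ∧ PartialsBddOn Ω U k K := by
  have hΩ := ha.mem_nhds hz hk
  have hfin : {l : List (Fin d ⊕ Fin d) | l.length ≤ k + k}.Finite := List.finite_length_le _ _
  have hlen : ∀ l : List (Fin d ⊕ Fin d), l.countP (fun i => i.isLeft) ≤ k →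
      l.countP (fun i => i.isRight) ≤ k → l.length ≤ k + k := by
    intro l h1 h2
    have := List.length_eq_countP_add_countP (fun i : Fin d ⊕ Fin d => i.isLeft) (l := l)
    simp only [Bool.not_eq_true, Sum.isLeft_eq_false] at this
    simp only [Bool.decide_eq_true] at this
    omega
  set D := fun l : List (Fin d ⊕ Fin d) =>
    iterDeriv (l.map pairVec) (fun r => K r.1 r.2) with hD
  have hev : ∀ᶠ q in 𝓝 (z, z), ∀ l ∈ {l : List (Fin d ⊕ Fin d) | l.length ≤ k + k}, l ≠ [] →
      l.countP (fun i => i.isLeft) ≤ k → l.countP (fun i => i.isRight) ≤ k →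
      IterDerivExists (Ω ×ˢ Ω) (l.map pairVec) (fun r => K r.1 r.2) q ∧
        |D l q| ≤ |D l (z, z)| + 1 := by
    rw [eventually_all_finite hfin]
    intro l _
    simp only [eventually_imp_distrib_left]
    intro h0 h1 h2
    obtain ⟨h3, h4⟩ := ha l h0 h1 h2
    refine h3.and ?_
    have : Tendsto (fun q => |D l q|) (𝓝 (z, z)) (𝓝 |D l (z, z)|) := h4.abs
    exact (this.eventually (gt_mem_nhds (lt_add_one _))).mono fun q hq => hq.le
  have hev' : ∀ᶠ q in 𝓝 (z, z), q.1 ∈ Ω :=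
    (continuous_fst.tendsto (z, z)).eventually hΩ
  obtain ⟨ε, hε, h⟩ := Metric.eventually_nhds_iff_ball.1 (hev.and hev')
  rw [← ball_prod_same] at h
  refine ⟨Metric.ball z ε, Metric.mem_ball_self hε, Metric.isOpen_ball, convex_ball z ε,
    Metric.isBounded_ball, fun x hx => (h (x, z) ⟨hx, Metric.mem_ball_self hε⟩).2, ?_, ?_⟩
  · exact fun l h0 h1 h2 x hx y hy => ((h (x, y) ⟨hx, hy⟩).1 l (hlen l h1 h2) h0 h1 h2).1
  · exact fun l h0 h1 h2 => ⟨_, fun x hx y hy =>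
      ((h (x, y) ⟨hx, hy⟩).1 l (hlen l h1 h2) h0 h1 h2).2⟩

variable {U : Set (EuclideanSpace ℝ (Fin d))}

theorem PartialsBddOn.hasLineDerivAt_left (h : PartialsBddOn Ω U k K)
    {l : List (Fin d ⊕ Fin d)} {i : Fin d} (h1 : l.countP (fun i => i.isLeft) + 1 ≤ k)
    (h2 : l.countP (fun i => i.isRight) ≤ k) {x y : EuclideanSpace ℝ (Fin d)} (hx : x ∈ U)
    (hy : y ∈ U) :
    HasLineDerivAt ℝ (fun ξ => iterDeriv (l.map pairVec) (fun r => K r.1 r.2) (ξ, y))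
      (iterDeriv ((Sum.inl i :: l).map pairVec) (fun r => K r.1 r.2) (x, y)) x (coordVec i) := by
  have := (h.iterExists (Sum.inl i :: l) (by simp) (by simpa [List.countP_cons] using h1) (by simpa [List.countP_cons] using h2)
    x hx y hy).2.hasLineDerivAt
  simpa [HasLineDerivAt, pairVec, iterDeriv] using this

theorem PartialsBddOn.hasLineDerivAt_right (h : PartialsBddOn Ω U k K)
    {l : List (Fin d ⊕ Fin d)} {i : Fin d} (h1 : l.countP (fun i => i.isLeft) ≤ k)
    (h2 : l.countP (fun i => i.isRight) + 1 ≤ k) {x y : EuclideanSpace ℝ (Fin d)} (hx : x ∈ U)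
    (hy : y ∈ U) :
    HasLineDerivAt ℝ (fun η => iterDeriv (l.map pairVec) (fun r => K r.1 r.2) (x, η))
      (iterDeriv ((Sum.inr i :: l).map pairVec) (fun r => K r.1 r.2) (x, y)) y (coordVec i) := by
  have := (h.iterExists (Sum.inr i :: l) (by simp) (by simpa [List.countP_cons] using h1) (by simpa [List.countP_cons] using h2)
    x hx y hy).2.hasLineDerivAt
  simpa [HasLineDerivAt, pairVec, iterDeriv] using this

theorem PartialsBddOn.bddMixedOn (h : PartialsBddOn Ω U k K) (n : ℕ)
    (l : List (Fin d ⊕ Fin d)) (h1 : l.countP (fun i => i.isLeft) + n ≤ k)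
    (h2 : l.countP (fun i => i.isRight) + n ≤ k) :
    BddMixedOn U n fun x y => iterDeriv (l.map pairVec) (fun r => K r.1 r.2) (x, y) := by
  induction n generalizing l with
  | zero => trivial
  | succ n ih =>
    intro i
    refine ⟨fun x y => iterDeriv ((Sum.inl i :: l).map pairVec) (fun r => K r.1 r.2) (x, y),
      fun x y => iterDeriv ((Sum.inr i :: Sum.inl i :: l).map pairVec) (fun r => K r.1 r.2) (x, y),
      fun x hx y hy => h.hasLineDerivAt_left (by omega) (by omega) hx hy,
      fun x hx y hy => h.hasLineDerivAt_right (by simp [List.countP_cons]; omega) (by simp; omega) hx hy,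
      h.iterBdd _ (by simp) (by simp [List.countP_cons]; omega) (by simp [List.countP_cons]; omega),
      ih _ (by simp [List.countP_cons]; omega) (by simp [List.countP_cons]; omega)⟩

theorem PartialsBddOn.bddPartialsOn (h : PartialsBddOn Ω U k K) {y : EuclideanSpace ℝ (Fin d)}
    (hy : y ∈ U) (n : ℕ)
    (l : List (Fin d ⊕ Fin d)) (h1 : l.countP (fun i => i.isLeft) + n ≤ k)
    (h2 : l.countP (fun i => i.isRight) ≤ k) :
    BddPartialsOn U n fun x => iterDeriv (l.map pairVec) (fun r => K r.1 r.2) (x, y) := by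
  induction n generalizing l with
  | zero => trivial
  | succ n ih =>
    intro i
    obtain ⟨C, hC⟩ := h.iterBdd (Sum.inl i :: l) (by simp) (by simp [List.countP_cons]; omega) (by simp; omega)
    exact ⟨fun x => iterDeriv ((Sum.inl i :: l).map pairVec) (fun r => K r.1 r.2) (x, y),
      fun x hx => h.hasLineDerivAt_left (by omega) (by omega) hx hy,
      ⟨C, fun x hx => hC x hx y hy⟩, ih _ (by simp [List.countP_cons]; omega) (by simp; omega)⟩

theorem iterDeriv_slice (l : List (Fin d)) (x y : EuclideanSpace ℝ (Fin d)) :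
    iterDeriv ((l.map Sum.inl).map pairVec) (fun r => K r.1 r.2) (x, y)
      = iterDeriv (l.map coordVec) (fun ξ => K ξ y) x := by
  induction l generalizing x with
  | nil => rfl
  | cons i l ih =>
    simp only [List.map_cons, iterDeriv, lineDeriv, pairVec, Prod.smul_mk, smul_zero,
      Prod.mk_add_mk, add_zero] at ih ⊢
    simp only [ih]

theorem IterDerivExists.slice {l : List (Fin d)} {x y : EuclideanSpace ℝ (Fin d)}
    (h : IterDerivExists (Ω ×ˢ Ω) ((l.map Sum.inl).map pairVec) (fun r => K r.1 r.2) (x, y)) :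
    IterDerivExists Ω (l.map coordVec) (fun ξ => K ξ y) x := by
  induction l generalizing x with
  | nil => exact h.1
  | cons i l ih =>
    refine ⟨?_, ?_⟩
    · have h2 : Tendsto (fun ξ => (ξ, y)) (𝓝 x) (𝓝 (x, y)) :=
        (Continuous.prodMk_left y).tendsto x
      filter_upwards [h2.eventually h.1] with ξ hξ using ih hξ
    · have := h.2
      simpa [LineDifferentiableAt, pairVec, iterDeriv, ← iterDeriv_slice] using this

/-- Lists of directions in the first block only are derivatives of the slices `K(·, y)`; this yields
`D'K(z, y)` for `y` near `z`. -/
theorem PartialsBddOn.iterDerivExists_slice (h : PartialsBddOn Ω U k K)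
    {x y : EuclideanSpace ℝ (Fin d)} (hx : x ∈ U) (hy : y ∈ U) {l : List (Fin d)}
    (hl : l.length ≤ k) : IterDerivExists Ω (l.map coordVec) (fun ξ => K ξ y) x := by
  rcases eq_or_ne l [] with rfl | h0
  · exact h.subset hx
  · refine IterDerivExists.slice (h.iterExists (l.map Sum.inl) (by simpa using h0) ?_ ?_ x hx y hy)
    · simpa [List.countP_map, Function.comp_def] using hl
    · simp [List.countP_map, Function.comp_def]

end Hypothesis

local notation "⟪" x ", " y "⟫" => inner ℝ x y

/-! ### Weak differentiability of Hilbert space valued maps -/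

section Weak

variable {H : Type*} [NormedAddCommGroup H] [InnerProductSpace ℝ H]

/-- By the uniform bound, replacing `u` by a nearby `u'` in `S` changes all inner products by
little, so the Cauchy property is inherited. The constant `C + 1` avoids division by zero. -/
theorem exists_tendsto_inner_of_mem_closure {α : Type*} {l : Filter α} [l.NeBot]
    {q : α → H} {C : ℝ} (hC : ∀ᶠ h in l, ‖q h‖ ≤ C) {S : Set H}
    (hS : ∀ u ∈ S, ∃ b, Tendsto (fun h => ⟪q h, u⟫) l (𝓝 b)) {u : H} (hu : u ∈ closure S) :
    ∃ b, Tendsto (fun h => ⟪q h, u⟫) l (𝓝 b) := by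
  have hC0 : 0 ≤ C := by
    obtain ⟨h, hh⟩ := hC.exists
    exact (norm_nonneg _).trans hh
  rw [← cauchy_map_iff_exists_tendsto, Metric.cauchy_iff]
  refine ⟨map_neBot, fun ε hε => ?_⟩
  obtain ⟨u', hu', hd⟩ := Metric.mem_closure_iff.1 hu (ε / (4 * (C + 1))) (by positivity)
  obtain ⟨b, hb⟩ := hS u' hu'
  have h1 : ∀ᶠ h in l, dist ⟪q h, u'⟫ b < ε / 4 := Metric.tendsto_nhds.1 hb _ (by positivity)
  refine ⟨(fun h => ⟪q h, u⟫) '' {h | ‖q h‖ ≤ C ∧ dist ⟪q h, u'⟫ b < ε / 4},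
    image_mem_map (hC.and h1), ?_⟩
  have key : ∀ h, ‖q h‖ ≤ C ∧ dist ⟪q h, u'⟫ b < ε / 4 → |⟪q h, u⟫ - b| < ε / 2 := by
    rintro h ⟨h1, h2⟩
    have h3 : |⟪q h, u⟫ - ⟪q h, u'⟫| ≤ ε / 4 := by
      rw [← inner_sub_right]
      refine (abs_real_inner_le_norm _ _).trans ?_
      have h4 : ‖u - u'‖ ≤ ε / (4 * (C + 1)) := by rw [← dist_eq_norm]; exact hd.le
      calc ‖q h‖ * ‖u - u'‖ ≤ (C + 1) * (ε / (4 * (C + 1))) := by gcongr; linarith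
        _ = ε / 4 := by field_simp
    rw [Real.dist_eq] at h2
    rw [abs_lt] at *
    rw [abs_le] at h3
    constructor <;> linarith
  rintro _ ⟨h, hh, rfl⟩ _ ⟨h', hh', rfl⟩
  have h1 := key h hh
  have h2 := key h' hh'
  rw [Real.dist_eq]
  rw [abs_lt] at *
  constructor <;> linarith

/-- `S` need not be total: on its closed span the limits exist by boundedness, and on the orthogonal
complement the inner products vanish because the `q h` lie in the span. The limit is a bounded
functional, hence represented by Riesz. -/
theorem exists_weak_limit [CompleteSpace H] {α : Type*} {l : Filter α} [l.NeBot]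
    {q : α → H} {C : ℝ} (hC : ∀ᶠ h in l, ‖q h‖ ≤ C) {S : Set H}
    (hqS : ∀ᶠ h in l, q h ∈ Submodule.span ℝ S)
    (hS : ∀ u ∈ S, ∃ b, Tendsto (fun h => ⟪q h, u⟫) l (𝓝 b)) :
    ∃ q₀ : H, ∀ u, Tendsto (fun h => ⟪q h, u⟫) l (𝓝 ⟪q₀, u⟫) := by
  have h1 : ∀ u ∈ Submodule.span ℝ S, ∃ b, Tendsto (fun h => ⟪q h, u⟫) l (𝓝 b) := by
    intro u hu
    induction hu using Submodule.span_induction with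
    | mem u hu => exact hS u hu
    | zero => exact ⟨0, by simp⟩
    | add u w _ _ hu hw =>
      obtain ⟨b, hb⟩ := hu
      obtain ⟨c, hc⟩ := hw
      exact ⟨b + c, by simpa only [inner_add_right] using hb.add hc⟩
    | smul r u _ hu =>
      obtain ⟨b, hb⟩ := hu
      exact ⟨r * b, by simpa only [inner_smul_right] using hb.const_mul r⟩
  set T := (Submodule.span ℝ S).topologicalClosure with hT
  have hTc : IsClosed (T : Set H) := Submodule.isClosed_topologicalClosure _
  have : CompleteSpace T := hTc.completeSpace_coe
  have h2 : ∀ u : H, ∃ b, Tendsto (fun h => ⟪q h, u⟫) l (𝓝 b) := by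
    intro u
    obtain ⟨y, hy, w, hw, rfl⟩ := T.exists_add_mem_mem_orthogonal u
    obtain ⟨b, hb⟩ := exists_tendsto_inner_of_mem_closure hC h1 hy
    refine ⟨b, hb.congr' ?_⟩
    filter_upwards [hqS] with h hh
    rw [inner_add_right, hw _ (Submodule.le_topologicalClosure _ hh), add_zero]
  choose b hb using h2
  let B : H →ₗ[ℝ] ℝ :=
    { toFun := b
      map_add' := fun u w => tendsto_nhds_unique (hb (u + w))
        (by simpa only [inner_add_right] using (hb u).add (hb w))
      map_smul' := fun r u => tendsto_nhds_unique (hb (r • u))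
        (by simpa only [inner_smul_right, RingHom.id_apply, smul_eq_mul] using (hb u).const_mul r) }
  have hB : ∀ u, ‖B u‖ ≤ C * ‖u‖ := by
    intro u
    refine le_of_tendsto (hb u).norm ?_
    filter_upwards [hC] with h hh
    exact (norm_inner_le_norm _ _).trans (by gcongr)
  refine ⟨(InnerProductSpace.toDual ℝ H).symm (B.mkContinuous C hB), fun u => ?_⟩
  rw [InnerProductSpace.toDual_symm_apply]
  exact hb u

variable {d : ℕ} {U : Set (EuclideanSpace ℝ (Fin d))}

theorem hasDerivAt_line {F : Type*} [NormedAddCommGroup F] [NormedSpace ℝ F] {f : F → ℝ}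
    {f' : ℝ} {x v : F} {t : ℝ} (h : HasLineDerivAt ℝ f f' (x + t • v) v) :
    HasDerivAt (fun s : ℝ => f (x + s • v)) f' t := by
  have h1 : HasDerivAt (fun s => f (x + t • v + s • v)) f' (t - t) := by
    rw [sub_self]; exact h
  have h2 := HasDerivAt.scomp (h := fun s => s - t) t h1 ((hasDerivAt_id t).sub_const t)
  simp only [one_smul] at h2
  refine h2.congr_of_eventuallyEq (Eventually.of_forall fun s => ?_)
  simp only [Function.comp, add_assoc, ← add_smul]
  congr 3; ring

/-- The left side is a mixed second difference of the kernel `⟪v ξ, v η⟫`. The mean value inequality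
in the second argument and then in the first gives one factor `|t|` each. -/
theorem norm_sub_le_of_bddMixedOn (hUc : Convex ℝ U) {v : EuclideanSpace ℝ (Fin d) → H}
    {g' g'' : EuclideanSpace ℝ (Fin d) → EuclideanSpace ℝ (Fin d) → ℝ}
    {e : EuclideanSpace ℝ (Fin d)} {C : ℝ}
    (h1 : ∀ x ∈ U, ∀ y ∈ U, HasLineDerivAt ℝ (fun ξ => ⟪v ξ, v y⟫) (g' x y) x e)
    (h2 : ∀ x ∈ U, ∀ y ∈ U, HasLineDerivAt ℝ (fun η => g' x η) (g'' x y) y e)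
    (hC : ∀ x ∈ U, ∀ y ∈ U, |g'' x y| ≤ C) {x : EuclideanSpace ℝ (Fin d)} {t : ℝ}
    (hx : x ∈ U) (hxt : x + t • e ∈ U) :
    ‖v (x + t • e) - v x‖ ^ 2 ≤ C * |t| * |t| := by
  have hC0 : 0 ≤ C := (abs_nonneg _).trans (hC x hx x hx)
  have hseg : ∀ s ∈ Set.uIcc 0 t, x + s • e ∈ U := by
    intro s hs
    have hconv : Convex ℝ {s : ℝ | x + s • e ∈ U} := by
      have h0 : {s : ℝ | x + s • e ∈ U} = (AffineMap.lineMap x (x + e) : ℝ →ᵃ[ℝ] _) ⁻¹' U := by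
        ext s; simp [AffineMap.lineMap_apply, add_comm]
      rw [h0]
      exact hUc.affine_preimage _
    have hs' : s ∈ segment ℝ (0 : ℝ) t := by rwa [segment_eq_uIcc]
    exact hconv.segment_subset (by simpa using hx) hxt hs'
  have hcu : Convex ℝ (Set.uIcc (0 : ℝ) t) := convex_uIcc 0 t
  have hb1 : ∀ ξ ∈ U, |g' ξ (x + t • e) - g' ξ x| ≤ C * |t| := by
    intro ξ hξ
    have := hcu.norm_image_sub_le_of_norm_hasDerivWithin_le (f := fun s => g' ξ (x + s • e))
      (f' := fun s => g'' ξ (x + s • e)) (C := C)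
      (fun s hs => (hasDerivAt_line (h2 ξ hξ _ (hseg s hs))).hasDerivWithinAt)
      (fun s hs => hC ξ hξ _ (hseg s hs)) Set.left_mem_uIcc Set.right_mem_uIcc
    simpa using this
  have := hcu.norm_image_sub_le_of_norm_hasDerivWithin_le
    (f := fun s => ⟪v (x + s • e), v (x + t • e)⟫ - ⟪v (x + s • e), v x⟫)
    (f' := fun s => g' (x + s • e) (x + t • e) - g' (x + s • e) x) (C := C * |t|)
    (fun s hs => ((hasDerivAt_line (h1 _ (hseg s hs) _ hxt)).sub
      (hasDerivAt_line (h1 _ (hseg s hs) _ hx))).hasDerivWithinAt)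
    (fun s hs => hb1 _ (hseg s hs)) Set.left_mem_uIcc Set.right_mem_uIcc
  simp only [zero_smul, add_zero, sub_zero, Real.norm_eq_abs] at this
  refine le_trans (le_of_eq ?_) ((le_abs_self _).trans this)
  rw [← real_inner_self_eq_norm_sq]
  simp only [inner_sub_left, inner_sub_right]
  ring

theorem hasLineDerivAt_iff_tendsto_inner {v : EuclideanSpace ℝ (Fin d) → H} {f : H} {b : ℝ}
    {x e : EuclideanSpace ℝ (Fin d)} :
    HasLineDerivAt ℝ (fun ξ => ⟪v ξ, f⟫) b x e ↔
      Tendsto (fun t : ℝ => ⟪t⁻¹ • (v (x + t • e) - v x), f⟫) (𝓝[≠] 0) (𝓝 b) := by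
  unfold HasLineDerivAt
  rw [hasDerivAt_iff_tendsto_slope_zero]
  simp only [zero_add, zero_smul, add_zero, real_inner_smul_left, inner_sub_left, smul_eq_mul]

/-- The difference quotients are bounded by `√C`, lie in the span of `v '' U`, and converge when
tested on it because the kernel has first derivatives. Their weak limit is `v' x`. -/
theorem exists_weak_partial [CompleteSpace H] (hU : IsOpen U) (hUc : Convex ℝ U) {n : ℕ}
    {v : EuclideanSpace ℝ (Fin d) → H} (hv : BddMixedOn U (n + 1) fun x y => ⟪v x, v y⟫)
    (i : Fin d) : ∃ v' : EuclideanSpace ℝ (Fin d) → H,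
      (∀ x ∈ U, ∀ f, HasLineDerivAt ℝ (fun ξ => ⟪v ξ, f⟫) ⟪v' x, f⟫ x (coordVec i)) ∧
        BddMixedOn U n fun x y => ⟪v' x, v' y⟫ := by
  obtain ⟨g', g'', h1, h2, ⟨C, hC⟩, h4⟩ := hv i
  have key : ∀ x ∈ U, ∃ q₀ : H, ∀ f,
      HasLineDerivAt ℝ (fun ξ => ⟪v ξ, f⟫) ⟪q₀, f⟫ x (coordVec i) := by
    intro x hx
    have hC0 : 0 ≤ C := (abs_nonneg _).trans (hC x hx x hx)
    have hev : ∀ᶠ t : ℝ in 𝓝[≠] 0, x + t • coordVec i ∈ U := by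
      have : Tendsto (fun t : ℝ => x + t • coordVec i) (𝓝 0) (𝓝 x) := by
        have : Continuous fun t : ℝ => x + t • coordVec i := by fun_prop
        simpa using this.tendsto 0
      exact (this.eventually (hU.mem_nhds hx)).filter_mono nhdsWithin_le_nhds
    suffices h : ∃ q₀ : H, ∀ f, Tendsto (fun t : ℝ =>
        ⟪t⁻¹ • (v (x + t • coordVec i) - v x), f⟫) (𝓝[≠] 0) (𝓝 ⟪q₀, f⟫) from
      h.imp fun q₀ hq f => hasLineDerivAt_iff_tendsto_inner.2 (hq f)
    refine exists_weak_limit (C := √C) (S := v '' U) ?_ ?_ ?_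
    · filter_upwards [hev, self_mem_nhdsWithin] with t ht ht0
      have ht0 : 0 < |t| := abs_pos.2 ht0
      have := norm_sub_le_of_bddMixedOn hUc h1 h2 hC hx ht
      refine Real.le_sqrt_of_sq_le ?_
      rw [norm_smul, mul_pow, norm_inv, Real.norm_eq_abs, inv_pow, inv_mul_le_iff₀ (by positivity)]
      linarith
    · filter_upwards [hev] with t ht
      exact Submodule.smul_mem _ _ (Submodule.sub_mem _
        (Submodule.subset_span ⟨_, ht, rfl⟩) (Submodule.subset_span ⟨_, hx, rfl⟩))
    · rintro _ ⟨y, hy, rfl⟩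
      exact ⟨g' x y, hasLineDerivAt_iff_tendsto_inner.1 (h1 x hx y hy)⟩
  choose! v' hv' using key
  refine ⟨v', hv', h4.congr hU fun x hx y hy => ?_⟩
  -- Uniqueness of derivatives identifies `⟪v η, v' x⟫` with the first derivative of the kernel.
  -- Testing weak differentiability at `y` against `v' x` then identifies the kernel of `v'` with
  -- `g''`.
  have e1 : ∀ η ∈ U, ⟪v η, v' x⟫ = g' x η := fun η hη => by
    rw [real_inner_comm]
    have := (hv' x hx (v η)).lineDeriv
    rw [(h1 x hx η hη).lineDeriv] at this
    exact this.symm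
  have e2 : HasLineDerivAt ℝ (fun η => g' x η) ⟪v' y, v' x⟫ y (coordVec i) := by
    refine (hv' y hy (v' x)).congr_of_eventuallyEq ?_
    filter_upwards [hU.mem_nhds hy] with η hη using (e1 η hη).symm
  rw [real_inner_comm, ← e2.lineDeriv, (h2 x hx y hy).lineDeriv]

/-- The functions `⟪v ·, f⟫` have partial derivatives up to order `n`, represented in `H`. -/
theorem exists_weak_iterDeriv [CompleteSpace H] {Ω : Set (EuclideanSpace ℝ (Fin d))}
    (hU : IsOpen U) (hUc : Convex ℝ U) (hUΩ : U ⊆ Ω) {n : ℕ}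
    {v : EuclideanSpace ℝ (Fin d) → H} (hv : BddMixedOn U n fun x y => ⟪v x, v y⟫)
    (l : List (Fin d)) (hl : l.length ≤ n) : ∃ V : EuclideanSpace ℝ (Fin d) → H, ∀ f, ∀ x ∈ U,
      IterDerivExists Ω (l.map coordVec) (fun ξ => ⟪v ξ, f⟫) x ∧
        iterDeriv (l.map coordVec) (fun ξ => ⟪v ξ, f⟫) x = ⟪V x, f⟫ := by
  -- The last entry is differentiated first: it replaces `v` by `v'` and uses up one order of
  -- smoothness of the kernel.
  induction l using List.reverseRecOn generalizing n v with
  | nil => exact ⟨v, fun f x hx => ⟨hUΩ hx, rfl⟩⟩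
  | append_singleton l i ih =>
    obtain ⟨n, rfl⟩ : ∃ m, n = m + 1 := ⟨n - 1, by simp at hl; omega⟩
    obtain ⟨v', hv', h'⟩ := exists_weak_partial hU hUc hv i
    obtain ⟨V, hV⟩ := ih h' (by simpa using hl)
    have he : ∀ f, ∀ x ∈ U, (fun ξ => ⟪v' ξ, f⟫) =ᶠ[𝓝 x]
        fun ξ => lineDeriv ℝ (fun ξ => ⟪v ξ, f⟫) ξ (coordVec i) := by
      intro f x hx
      filter_upwards [hU.mem_nhds hx] with ξ hξ using (hv' ξ hξ f).lineDeriv.symm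
    refine ⟨V, fun f x hx => ?_⟩
    rw [List.map_append, List.map_singleton]
    refine ⟨IterDerivExists.append_singleton hU hUΩ
      (fun y hy => (hv' y hy f).lineDifferentiableAt) (fun y hy => ?_) x hx, ?_⟩
    · exact (hV f y hy).1.congr (he f y hy)
    · rw [iterDeriv_append_singleton, ← (iterDeriv_congr (he f x hx) _).self_of_nhds,
        (hV f x hx).2]

end Weak

/-! ### Reproduction of a finite-dimensional space from finitely many functionals -/

section Interpolation

/-- A maximal independent subfamily of the functionals `φ x` is finite and admits dual vectors `p
j`; expanding `φ x` in it gives the formula. Thus the index set need not separate the points of `V`.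
-/
theorem exists_biorthogonal {V X : Type*} [AddCommGroup V] [Module ℝ V] [FiniteDimensional ℝ V]
    (φ : X → Module.Dual ℝ V) : ∃ (n : ℕ) (y : Fin n → X) (p : Fin n → V),
      ∀ q x, φ x q = ∑ j, φ x (p j) * φ (y j) q := by
  classical
  obtain ⟨b, hb, hspan, hli⟩ := exists_linearIndependent ℝ (Set.range φ)
  have hbf : b.Finite := hli.setFinite
  have := hbf.fintype
  choose y hy using fun j : b => hb j.2
  have hp : ∀ j : b, ∃ v : V, j.1 v = 1 ∧ ∀ i : b, i ≠ j → i.1 v = 0 := by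
    intro j
    -- Since `j` is not in the span of the others, their common kernel contains a vector on which
    -- `j` does not vanish; rescaling it gives the dual vector.
    have hj : j.1 ∉ Submodule.span ℝ (Set.range fun i : {i : b // i ≠ j} => i.1.1) := by
      have h0 : Set.range (fun i : {i : b // i ≠ j} => i.1.1) = Subtype.val '' {i | i ≠ j} := by
        ext f; simp
      rw [h0]
      exact hli.notMem_span_image (s := {i | i ≠ j}) (x := j) (by simp)
    have h1 := mt (mem_span_of_iInf_ker_le_ker (L := fun i : {i : b // i ≠ j} => i.1.1)
      (K := j.1)) hj
    obtain ⟨v, hv, hv'⟩ := SetLike.not_le_iff_exists.1 h1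
    rw [LinearMap.mem_ker] at hv'
    refine ⟨(j.1 v)⁻¹ • v, by simp [hv'], fun i hi => ?_⟩
    have := (Submodule.mem_iInf _).1 hv ⟨i, hi⟩
    rw [LinearMap.mem_ker] at this
    simp [this]
  choose p hp1 hp2 using hp
  let e := Fintype.equivFin b
  refine ⟨Fintype.card b, fun j => y (e.symm j), fun j => p (e.symm j), fun q x => ?_⟩
  rw [Equiv.sum_comp e.symm fun j => φ x (p j) * φ (y j) q]
  have hx : φ x ∈ Submodule.span ℝ (Set.range fun j : b => j.1) := by
    rw [Subtype.range_coe, hspan]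
    exact Submodule.subset_span ⟨x, rfl⟩
  obtain ⟨c, hc⟩ := (Submodule.mem_span_range_iff_exists_fun ℝ).1 hx
  have hc' : ∀ j, φ x (p j) = c j := by
    intro j
    rw [← hc, LinearMap.sum_apply, Finset.sum_eq_single j]
    · simp [hp1]
    · intro i _ hi; simp [hp2 j i hi]
    · simp
  simp only [hc', hy]
  conv_lhs => rw [← hc]
  simp [LinearMap.sum_apply]

end Interpolation

/-! ### The Hilbert space model of the native space -/

section Native

variable {d s : ℕ} {Ω : Set (EuclideanSpace ℝ (Fin d))}
  {K : EuclideanSpace ℝ (Fin d) → EuclideanSpace ℝ (Fin d) → ℝ}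

theorem polyFun_add (p q : MvPolynomial (Fin d) ℝ) (x : EuclideanSpace ℝ (Fin d)) :
    polyFun (p + q) x = polyFun p x + polyFun q x := map_add _ _ _

theorem polyFun_smul (c : ℝ) (p : MvPolynomial (Fin d) ℝ) (x : EuclideanSpace ℝ (Fin d)) :
    polyFun (c • p) x = c * polyFun p x := MvPolynomial.smul_eval _ _ _

/-- Point evaluation as a linear functional on `Π^d_s`. -/
noncomputable def polyEval (d s : ℕ) (x : EuclideanSpace ℝ (Fin d)) :
    Module.Dual ℝ (polySpace d s) where
  toFun q := polyFun q.1 x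
  map_add' _ _ := polyFun_add _ _ _
  map_smul' _ _ := polyFun_smul _ _ _

theorem exists_poly_interpolation [FiniteDimensional ℝ (polySpace d s)]
    (Y : Set (EuclideanSpace ℝ (Fin d))) :
    ∃ (n : ℕ) (y : Fin n → EuclideanSpace ℝ (Fin d)) (p : Fin n → MvPolynomial (Fin d) ℝ),
      (∀ j, y j ∈ Y) ∧ (∀ j, p j ∈ polySpace d s) ∧
      ∀ q ∈ polySpace d s, ∀ x ∈ Y, polyFun q x = ∑ j, polyFun (p j) x * polyFun q (y j) := by
  obtain ⟨n, y, p, h⟩ := exists_biorthogonal fun x : Y => polyEval d s x.1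
  exact ⟨n, fun j => y j, fun j => p j, fun j => (y j).2, fun j => (p j).2,
    fun q hq x hx => h ⟨q, hq⟩ ⟨x, hx⟩⟩

/-- The value `∑ c_x f(x)` of a finitely supported functional. -/
noncomputable def pairing (f : EuclideanSpace ℝ (Fin d) → ℝ) :
    (EuclideanSpace ℝ (Fin d) →₀ ℝ) →ₗ[ℝ] ℝ :=
  Finsupp.linearCombination ℝ f

theorem pairing_apply (f : EuclideanSpace ℝ (Fin d) → ℝ) (c : EuclideanSpace ℝ (Fin d) →₀ ℝ) :
    pairing f c = ∑ x ∈ c.support, c x * f x := rfl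

@[simp] theorem pairing_single (f : EuclideanSpace ℝ (Fin d) → ℝ) (x : EuclideanSpace ℝ (Fin d))
    (b : ℝ) : pairing f (Finsupp.single x b) = b * f x := by
  simp [pairing]

theorem pairing_add_fun (f g : EuclideanSpace ℝ (Fin d) → ℝ)
    (c : EuclideanSpace ℝ (Fin d) →₀ ℝ) :
    pairing (fun x => f x + g x) c = pairing f c + pairing g c := by
  simp only [pairing_apply, mul_add, Finset.sum_add_distrib]

/-- The bilinear form `∑ c_x c'_y K(x, y)`. -/
noncomputable def kernelForm (K : EuclideanSpace ℝ (Fin d) → EuclideanSpace ℝ (Fin d) → ℝ)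
    (c c' : EuclideanSpace ℝ (Fin d) →₀ ℝ) : ℝ :=
  pairing (fun x => pairing (K x) c') c

theorem energy_eq_kernelForm (c : EuclideanSpace ℝ (Fin d) →₀ ℝ) :
    energy K c = kernelForm K c c := by
  simp only [energy, kernelForm, pairing_apply, Finsupp.sum, Finset.mul_sum, mul_assoc]

theorem kernelForm_comm (hK : IsCPD Ω s K) {c c' : EuclideanSpace ℝ (Fin d) →₀ ℝ}
    (hc : IsAnnihilator Ω s c) (hc' : IsAnnihilator Ω s c') :
    kernelForm K c c' = kernelForm K c' c := by
  simp only [kernelForm, pairing_apply, Finset.mul_sum]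
  rw [Finset.sum_comm]
  refine Finset.sum_congr rfl fun x hx => Finset.sum_congr rfl fun y hy => ?_
  rw [hK.1 y (hc.1 y hy) x (hc'.1 x hx)]; ring

theorem IsAnnihilator.pairing_eq_zero {c : EuclideanSpace ℝ (Fin d) →₀ ℝ}
    (hc : IsAnnihilator Ω s c) {p : MvPolynomial (Fin d) ℝ} (hp : p ∈ polySpace d s) :
    pairing (polyFun p) c = 0 := hc.2 p hp

theorem pairing_kernelSum {c c' : EuclideanSpace ℝ (Fin d) →₀ ℝ} (hc : IsAnnihilator Ω s c)
    {p : MvPolynomial (Fin d) ℝ} (hp : p ∈ polySpace d s) :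
    pairing (kernelSum K c' p) c = kernelForm K c c' := by
  have : kernelSum K c' p = fun y => pairing (K y) c' + polyFun p y := rfl
  rw [this, pairing_add_fun, hc.pairing_eq_zero hp, add_zero]; rfl

/-- The functionals supported on finitely many points of `Ω` that annihilate `Π^d_s`. -/
def annihilators (Ω : Set (EuclideanSpace ℝ (Fin d))) (s : ℕ) :
    Submodule ℝ (EuclideanSpace ℝ (Fin d) →₀ ℝ) where
  carrier := {c | IsAnnihilator Ω s c}
  zero_mem' := ⟨by simp, by simp⟩
  add_mem' := by
    classical
    intro b c hb hc
    refine ⟨fun x hx => ?_, fun p hp => ?_⟩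
    · rcases Finset.mem_union.1 (Finsupp.support_add hx) with h | h
      exacts [hb.1 x h, hc.1 x h]
    · change pairing (polyFun p) (b + c) = 0
      rw [map_add, hb.pairing_eq_zero hp, hc.pairing_eq_zero hp, add_zero]
  smul_mem' := by
    intro r c hc
    refine ⟨fun x hx => hc.1 x (Finsupp.support_smul hx), fun p hp => ?_⟩
    change pairing (polyFun p) (r • c) = 0
    rw [map_smul, hc.pairing_eq_zero hp, smul_zero]

/-- The functional `f ↦ ∑ b_j f(y_j)`. -/
noncomputable def pointSum {ι : Type*} [Fintype ι] (y : ι → EuclideanSpace ℝ (Fin d)) :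
    (ι → ℝ) →ₗ[ℝ] EuclideanSpace ℝ (Fin d) →₀ ℝ :=
  Fintype.linearCombination ℝ fun j => Finsupp.single (y j) 1

section PointSum

variable {ι : Type*} [Fintype ι] (y : ι → EuclideanSpace ℝ (Fin d))

@[simp] theorem pairing_pointSum (f : EuclideanSpace ℝ (Fin d) → ℝ) (b : ι → ℝ) :
    pairing f (pointSum y b) = ∑ j, b j * f (y j) := by
  simp [pointSum, Fintype.linearCombination_apply]

theorem mem_range_of_mem_support_pointSum {b : ι → ℝ} {x : EuclideanSpace ℝ (Fin d)}
    (hx : x ∈ (pointSum y b).support) : x ∈ Set.range y := by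
  classical
  rw [pointSum, Fintype.linearCombination_apply] at hx
  obtain ⟨j, -, hxj⟩ := Finset.mem_biUnion.1 (Finsupp.support_finsetSum hx)
  exact ⟨j, (Finset.mem_singleton.1
    (Finsupp.support_single_subset (Finsupp.support_smul hxj))).symm⟩

theorem pointSum_injective {y : ι → EuclideanSpace ℝ (Fin d)} (hy : Function.Injective y) :
    Function.Injective (pointSum y) := by
  classical
  intro b b' h
  funext j
  have := DFunLike.congr_fun h (y j)
  simpa [pointSum, Fintype.linearCombination_apply, Finsupp.finsetSum_apply,
    Finsupp.single_apply, hy.eq_iff] using this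

end PointSum

/-- The inner product on the annihilating functionals given by the kernel. -/
noncomputable abbrev annihilatorsCore (hK : IsCPD Ω s K) :
    InnerProductSpace.Core ℝ (annihilators Ω s) where
  inner c c' := kernelForm K c c'
  conj_inner_symm c c' := kernelForm_comm hK c'.2 c.2
  re_inner_nonneg c := by
    change 0 ≤ kernelForm K c c
    rw [← energy_eq_kernelForm]
    rcases eq_or_ne c.1 0 with h | h
    · rw [h]; simp [energy]
    · exact (hK.2 _ c.2 h).le
  add_left b c c' := map_add (pairing _) _ _
  smul_left b c r := map_smul (pairing _) _ _
  definite c hc := by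
    by_contra h
    have h1 : c.1 ≠ 0 := fun h' => h (Subtype.ext h')
    have h2 := hK.2 _ c.2 h1
    rw [energy_eq_kernelForm] at h2
    exact h2.ne' hc

/-- `J` represents the form given by the kernel on the annihilating functionals, with dense
image. -/
structure IsFeatureMap {H : Type*} [NormedAddCommGroup H] [InnerProductSpace ℝ H]
    (Ω : Set (EuclideanSpace ℝ (Fin d))) (s : ℕ)
    (K : EuclideanSpace ℝ (Fin d) → EuclideanSpace ℝ (Fin d) → ℝ)
    (J : (EuclideanSpace ℝ (Fin d) →₀ ℝ) →ₗ[ℝ] H) : Prop where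
  inner_eq : ∀ c c', IsAnnihilator Ω s c → IsAnnihilator Ω s c' → ⟪J c, J c'⟫ = kernelForm K c c'
  dense : ∀ u : H, u ∈ closure (J '' {c | IsAnnihilator Ω s c})

theorem exists_isFeatureMap (hK : IsCPD Ω s K) :
    ∃ (H : Type) (_ : NormedAddCommGroup H) (_ : InnerProductSpace ℝ H) (_ : CompleteSpace H)
      (J : (EuclideanSpace ℝ (Fin d) →₀ ℝ) →ₗ[ℝ] H), IsFeatureMap Ω s K J := by
  let _ : NormedAddCommGroup (annihilators Ω s) := (annihilatorsCore hK).toNormedAddCommGroup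
  let _ : InnerProductSpace ℝ (annihilators Ω s) :=
    InnerProductSpace.ofCore (annihilatorsCore hK).toCore
  let T : annihilators Ω s →ₗᵢ[ℝ] UniformSpace.Completion (annihilators Ω s) :=
    UniformSpace.Completion.toComplₗᵢ
  -- The values of `J` off the annihilators are arbitrary and carry no meaning; the extension only
  -- makes linearity available without membership proofs.
  obtain ⟨J, hJ⟩ := LinearMap.exists_extend T.toLinearMap
  have hJ' : ∀ c (hc : IsAnnihilator Ω s c), J c = T ⟨c, hc⟩ := fun c hc =>
    LinearMap.congr_fun hJ ⟨c, hc⟩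
  refine ⟨UniformSpace.Completion (annihilators Ω s), inferInstance, inferInstance, inferInstance,
    J, fun c c' hc hc' => ?_, fun u => ?_⟩
  · rw [hJ' c hc, hJ' c' hc', T.inner_map_map]; rfl
  · have h1 : u ∈ closure (Set.range T) :=
      (UniformSpace.Completion.denseRange_coe (α := annihilators Ω s)) u
    refine closure_mono ?_ h1
    rintro _ ⟨c, rfl⟩
    exact ⟨c.1, c.2, hJ' c.1 c.2⟩

variable {H : Type*} [NormedAddCommGroup H] [InnerProductSpace ℝ H]
  {J : (EuclideanSpace ℝ (Fin d) →₀ ℝ) →ₗ[ℝ] H}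

theorem IsFeatureMap.norm_eq (hJ : IsFeatureMap Ω s K J) {c : EuclideanSpace ℝ (Fin d) →₀ ℝ}
    (hc : IsAnnihilator Ω s c) : ‖J c‖ = √(energy K c) := by
  rw [energy_eq_kernelForm, ← hJ.inner_eq c c hc hc, real_inner_self_eq_norm_sq,
    Real.sqrt_sq (norm_nonneg _)]

theorem IsFeatureMap.ext (hJ : IsFeatureMap Ω s K J) {u u' : H}
    (h : ∀ c, IsAnnihilator Ω s c → ⟪J c, u⟫ = ⟪J c, u'⟫) : u = u' := by
  have : J '' {c | IsAnnihilator Ω s c} ⊆ {w | ⟪w, u⟫ = ⟪w, u'⟫} := by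
    rintro _ ⟨c, hc, rfl⟩
    exact h c hc
  have hcl : IsClosed {w : H | ⟪w, u⟫ = ⟪w, u'⟫} := isClosed_eq (by fun_prop) (by fun_prop)
  exact ext_inner_left ℝ fun w => hcl.closure_subset_iff.2 this (hJ.dense w)

/-- The Cauchy sequence of coefficients converges in `H`. An annihilating functional does not see
the polynomial parts, which need not converge in any sense by themselves, so its values pass to the
limit. -/
theorem IsFeatureMap.exists_of_hasNativeNorm [CompleteSpace H] (hJ : IsFeatureMap Ω s K J)
    {f : EuclideanSpace ℝ (Fin d) → ℝ} {r : ℝ} (hf : HasNativeNorm Ω s K f r) :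
    ∃ u : H, ‖u‖ = r ∧ ∀ c, IsAnnihilator Ω s c → pairing f c = ⟪J c, u⟫ := by
  obtain ⟨c, p, hc, hp, hcau, hlim, hr⟩ := hf
  have h1 : CauchySeq fun n => J (c n) := by
    refine Metric.cauchySeq_iff.2 fun ε hε => ?_
    obtain ⟨n₀, h⟩ := hcau ε hε
    refine ⟨n₀, fun m hm n hn => ?_⟩
    rw [dist_eq_norm, ← map_sub, hJ.norm_eq ((annihilators Ω s).sub_mem (hc m) (hc n))]
    exact h m hm n hn
  obtain ⟨u, hu⟩ := cauchySeq_tendsto_of_complete h1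
  refine ⟨u, tendsto_nhds_unique hu.norm ?_, fun b hb => ?_⟩
  · simpa only [hJ.norm_eq (hc _)] using hr
  · have h2 : Tendsto (fun n => pairing (kernelSum K (c n) (p n)) b) atTop (𝓝 (pairing f b)) := by
      simp only [pairing_apply]
      exact tendsto_finsetSum _ fun y hy => (hlim y (hb.1 y hy)).const_mul (b y)
    refine tendsto_nhds_unique h2 ?_
    simp only [pairing_kernelSum hb (hp _), ← hJ.inner_eq b _ hb (hc _)]
    exact tendsto_const_nhds.inner hu

/-- By density `f` determines `u`, so all approximating sequences give the same seminorm and the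
infimum is over a single number. -/
theorem IsFeatureMap.exists_of_mem_nativeSpace [CompleteSpace H] (hJ : IsFeatureMap Ω s K J)
    {f : EuclideanSpace ℝ (Fin d) → ℝ} (hf : f ∈ nativeSpace Ω s K) :
    ∃ u : H, nativeNorm Ω s K f = ‖u‖ ∧ ∀ c, IsAnnihilator Ω s c → pairing f c = ⟪J c, u⟫ := by
  obtain ⟨r, hr⟩ := hf
  obtain ⟨u, hu, h⟩ := hJ.exists_of_hasNativeNorm hr
  refine ⟨u, ?_, h⟩
  have : {r | HasNativeNorm Ω s K f r} = {‖u‖} := by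
    ext t
    refine ⟨fun ht => ?_, fun ht => ?_⟩
    · obtain ⟨u', hu', h'⟩ := hJ.exists_of_hasNativeNorm ht
      have : u' = u := hJ.ext fun c hc => by rw [← h c hc, ← h' c hc]
      rw [← hu', this]; rfl
    · rw [Set.mem_singleton_iff.1 ht, hu]; exact hr
  rw [nativeNorm, this, csInf_singleton]

theorem kernelSum_mem_nativeSpace {c : EuclideanSpace ℝ (Fin d) →₀ ℝ}
    (hc : IsAnnihilator Ω s c) : kernelSum K c 0 ∈ nativeSpace Ω s K :=
  ⟨√(energy K c), fun _ => c, fun _ => 0, fun _ => hc, fun _ => Submodule.zero_mem _,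
    fun ε hε => ⟨0, fun m _ n _ => by simpa [energy] using hε⟩, fun _ _ => tendsto_const_nhds,
    tendsto_const_nhds⟩

end Native

/-! ### Representation of the differential operator and of the error functionals -/

section LocalRep

variable {d s k : ℕ} {Ω : Set (EuclideanSpace ℝ (Fin d))}
  {K : EuclideanSpace ℝ (Fin d) → EuclideanSpace ℝ (Fin d) → ℝ}
  {H : Type*} [NormedAddCommGroup H] [InnerProductSpace ℝ H]
  {J : (EuclideanSpace ℝ (Fin d) →₀ ℝ) →ₗ[ℝ] H}

/-- The functional `f ↦ f(x) - ∑ p_j(x) f(y_j)`. -/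
noncomputable def interpError {n : ℕ} (y : Fin n → EuclideanSpace ℝ (Fin d))
    (p : Fin n → MvPolynomial (Fin d) ℝ) (x : EuclideanSpace ℝ (Fin d)) :
    EuclideanSpace ℝ (Fin d) →₀ ℝ :=
  Finsupp.single x 1 - pointSum y fun j => polyFun (p j) x

/-- The points `y` of `Y` and the polynomials `p` in `Π^d_s` reproduce `Π^d_s` on `Y`. -/
structure IsInterpolation {n : ℕ} (Y : Set (EuclideanSpace ℝ (Fin d))) (s : ℕ)
    (y : Fin n → EuclideanSpace ℝ (Fin d)) (p : Fin n → MvPolynomial (Fin d) ℝ) : Prop where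
  mem : ∀ j, y j ∈ Y
  poly_mem : ∀ j, p j ∈ polySpace d s
  eq_sum : ∀ q ∈ polySpace d s, ∀ x ∈ Y, polyFun q x = ∑ j, polyFun (p j) x * polyFun q (y j)

variable {n : ℕ} {y : Fin n → EuclideanSpace ℝ (Fin d)} {p : Fin n → MvPolynomial (Fin d) ℝ}
  {Y : Set (EuclideanSpace ℝ (Fin d))}

theorem pairing_interpError (f : EuclideanSpace ℝ (Fin d) → ℝ) (x : EuclideanSpace ℝ (Fin d)) :
    pairing f (interpError y p x) = f x - ∑ j, polyFun (p j) x * f (y j) := by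
  simp [interpError]

theorem IsInterpolation.support_interpError (h : IsInterpolation Y s y p)
    {x : EuclideanSpace ℝ (Fin d)} (hx : x ∈ Y) :
    ∀ ξ ∈ (interpError y p x).support, ξ ∈ Y := by
  classical
  intro ξ hξ
  rcases Finset.mem_union.1 (Finsupp.support_sub hξ) with h1 | h1
  · rwa [Finset.mem_singleton.1 (Finsupp.support_single_subset h1)]
  · obtain ⟨j, rfl⟩ := mem_range_of_mem_support_pointSum y h1
    exact h.mem j

theorem IsInterpolation.isAnnihilator (h : IsInterpolation Y s y p) (hY : Y ⊆ Ω)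
    {x : EuclideanSpace ℝ (Fin d)} (hx : x ∈ Y) : IsAnnihilator Ω s (interpError y p x) := by
  refine ⟨fun ξ hξ => hY (h.support_interpError hx ξ hξ), fun q hq => ?_⟩
  change pairing (polyFun q) _ = 0
  rw [pairing_interpError, h.eq_sum q hq x hx, sub_self]

/-- Expanding both functionals leaves `K(ξ, η)`, products of slices `K(·, y_j)` with polynomials,
and products of two polynomials. The slices have bounded partial derivatives because the points
`y_j` lie in `Y`, and symmetry of `K` treats the second argument like the first. -/
theorem IsInterpolation.bddMixedOn (h : IsInterpolation Y s y p) (hK : IsCPD Ω s K)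
    (hY : PartialsBddOn Ω Y k K) (hJ : IsFeatureMap Ω s K J) :
    BddMixedOn Y k fun ξ η => ⟪J (interpError y p ξ), J (interpError y p η)⟫ := by
  have hKb : BddMixedOn Y k fun ξ η => K ξ η := hY.bddMixedOn k [] (by simp) (by simp)
  have hKs : ∀ j, BddPartialsOn Y k fun ξ => K ξ (y j) := fun j =>
    hY.bddPartialsOn (h.mem j) k [] (by simp) (by simp)
  have hp : ∀ j, BddPartialsOn Y k (polyFun (p j)) := fun j =>
    bddPartialsOn_polyFun hY.bounded k (p j)
  have key := ((hKb.add (BddMixedOn.sum Finset.univ fun j => (hKs j).prod (hp j) (-1))).add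
    (BddMixedOn.sum Finset.univ fun i => (hp i).prod (hKs i) (-1))).add
    (BddMixedOn.sum Finset.univ fun i => BddMixedOn.sum Finset.univ fun j =>
      (hp i).prod (hp j) (K (y i) (y j)))
  refine key.congr hY.isOpen fun ξ hξ η hη => ?_
  rw [hJ.inner_eq _ _ (h.isAnnihilator hY.subset hξ) (h.isAnnihilator hY.subset hη), kernelForm,
    pairing_interpError]
  simp only [pairing_interpError, hK.1 _ (hY.subset (h.mem _)) η (hY.subset hη), mul_sub,
    Finset.sum_sub_distrib, neg_mul, one_mul, Finset.sum_neg_distrib, Finset.mul_sum]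
  have e1 : ∑ j, K ξ (y j) * polyFun (p j) η = ∑ j, polyFun (p j) η * K ξ (y j) :=
    Finset.sum_congr rfl fun j _ => mul_comm _ _
  have e2 : ∑ i, ∑ j, K (y i) (y j) * (polyFun (p i) ξ * polyFun (p j) η)
      = ∑ i, ∑ j, polyFun (p i) ξ * (polyFun (p j) η * K (y i) (y j)) :=
    Finset.sum_congr rfl fun i _ => Finset.sum_congr rfl fun j _ => by ring
  rw [e1, e2]
  ring

variable {z : EuclideanSpace ℝ (Fin d)} {a : (Fin d → ℕ) → EuclideanSpace ℝ (Fin d) → ℝ}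

theorem exists_diffOp_representer {v : EuclideanSpace ℝ (Fin d) → H}
    (h : ∀ α ∈ multiIndices d k, ∃ V : H, ∀ u,
      IterDerivExists Ω (multiIndexDirs α) (fun ξ => ⟪v ξ, u⟫) z ∧
        iterDeriv (multiIndexDirs α) (fun ξ => ⟪v ξ, u⟫) z = ⟪V, u⟫) :
    ∃ D : H, ∀ u, DiffOpExists Ω k a (fun ξ => ⟪v ξ, u⟫) z ∧
      diffOp k a (fun ξ => ⟪v ξ, u⟫) z = ⟪D, u⟫ := by
  choose! V hV using h
  refine ⟨∑ α ∈ multiIndices d k, a α z • V α, fun u => ⟨fun α hα _ => (hV α hα u).1, ?_⟩⟩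
  rw [sum_inner, diffOp]
  exact Finset.sum_congr rfl fun α hα => by rw [(hV α hα u).2, real_inner_smul_left]

theorem exists_local_representer [CompleteSpace H] [FiniteDimensional ℝ (polySpace d s)]
    (hK : IsCPD Ω s K) (hJ : IsFeatureMap Ω s K J) (hz : z ∈ Ω) (ha : HasMixedPartials Ω k K z) :
    ∃ (Y : Set (EuclideanSpace ℝ (Fin d))) (n : ℕ) (y : Fin n → EuclideanSpace ℝ (Fin d))
      (p : Fin n → MvPolynomial (Fin d) ℝ) (D : H),
      z ∈ Y ∧ Y ⊆ Ω ∧ (k = 0 ∨ Y ∈ 𝓝 z) ∧ IsInterpolation Y s y p ∧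
      (∀ ξ ∈ Y, DiffOpExists Ω k a (fun x => K x ξ) z) ∧
      ∀ u, DiffOpExists Ω k a (fun ξ => ⟪J (interpError y p ξ), u⟫) z ∧
        diffOp k a (fun ξ => ⟪J (interpError y p ξ), u⟫) z = ⟪D, u⟫ := by
  -- For `k = 0` there is no smoothness and possibly no neighbourhood: all of `Ω` serves as `Y`, and
  -- `D` is a multiple of evaluation at `z`.
  rcases eq_or_ne k 0 with rfl | hk
  · obtain ⟨n, y, p, h1, h2, h3⟩ := exists_poly_interpolation (s := s) Ω
    have hnil : ∀ α ∈ multiIndices d 0, multiIndexDirs α = [] := fun α hα =>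
      (multiIndexDirs_eq_nil_or hα (p := False) (Or.inl rfl)).resolve_right id
    obtain ⟨D, hD⟩ := exists_diffOp_representer (Ω := Ω) (a := a) (k := 0) (z := z)
      (v := fun ξ => J (interpError y p ξ))
      fun α hα => ⟨J (interpError y p z), fun u => by rw [hnil α hα]; exact ⟨hz, rfl⟩⟩
    refine ⟨Ω, n, y, p, D, hz, subset_rfl, Or.inl rfl, ⟨h1, h2, h3⟩, fun ξ _ α hα _ => ?_, hD⟩
    rw [hnil α hα]; exact hz
  · obtain ⟨Y, hzY, hY⟩ := ha.exists_partialsBddOn hz hk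
    obtain ⟨n, y, p, h1, h2, h3⟩ := exists_poly_interpolation (s := s) Y
    have hint : IsInterpolation Y s y p := ⟨h1, h2, h3⟩
    have hb := hint.bddMixedOn hK hY hJ
    obtain ⟨D, hD⟩ := exists_diffOp_representer (Ω := Ω) (a := a) (k := k) (z := z)
      (v := fun ξ => J (interpError y p ξ)) fun α hα => by
        obtain ⟨l, hl, hlen⟩ := exists_list_of_mem_multiIndices hα
        obtain ⟨V, hV⟩ := exists_weak_iterDeriv hY.isOpen hY.convex hY.subset hb l hlen
        exact ⟨V z, fun u => by rw [hl]; exact hV u z hzY⟩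
    refine ⟨Y, n, y, p, D, hzY, hY.subset, Or.inr (hY.isOpen.mem_nhds hzY), hint,
      fun ξ hξ α hα _ => ?_, hD⟩
    obtain ⟨l, hl, hlen⟩ := exists_list_of_mem_multiIndices hα
    rw [hl]
    exact hY.iterDerivExists_slice hzY hξ hlen

/-- On `Y` the function is `⟪J λ_ξ, u⟫ + ∑ f(y_j) p_j(ξ)`, and `D` is applied term by term. -/
theorem diffOp_eq_of_interpError (hzY : z ∈ Y) (hYΩ : Y ⊆ Ω)
    (hY : k = 0 ∨ Y ∈ 𝓝 z) {D u : H}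
    (hD : DiffOpExists Ω k a (fun ξ => ⟪J (interpError y p ξ), u⟫) z ∧
      diffOp k a (fun ξ => ⟪J (interpError y p ξ), u⟫) z = ⟪D, u⟫)
    {f : EuclideanSpace ℝ (Fin d) → ℝ}
    (hf : ∀ ξ ∈ Y, pairing f (interpError y p ξ) = ⟪J (interpError y p ξ), u⟫) :
    DiffOpExists Ω k a f z ∧
      diffOp k a f z = ⟪D, u⟫ + ∑ j, diffOp k a (polyFun (p j)) z * f (y j) := by
  have hΩ : k = 0 ∨ Ω ∈ 𝓝 z := hY.imp_right fun h => mem_of_superset h hYΩ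
  have h1 := diffOpExists_sum (a := a) (hYΩ hzY) hΩ Finset.univ (fun j => f (y j))
    fun j _ => diffOpExists_polyFun (hYΩ hzY) hΩ (p j)
  have h2 := hD.1.lin 1 1 h1.1
  have h3 : ∀ ξ ∈ Y, 1 * ⟪J (interpError y p ξ), u⟫ + 1 * ∑ j, f (y j) * polyFun (p j) ξ
      = f ξ := by
    intro ξ hξ
    rw [← hf ξ hξ, pairing_interpError]
    simp only [mul_comm (f _)]
    ring
  refine ⟨h2.1.congr (hYΩ hzY) hY h3, ?_⟩
  rw [← diffOp_congr hzY hY h3, h2.2, h1.2, hD.2, one_mul, one_mul]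
  simp only [mul_comm (f _)]

variable {N : ℕ} {x : Fin N → EuclideanSpace ℝ (Fin d)}

theorem isAnnihilator_pointSum (hxΩ : ∀ i, x i ∈ Ω) {c : Fin N → ℝ}
    (hc : ∀ q ∈ polySpace d s, ∑ i, c i * polyFun q (x i) = 0) :
    IsAnnihilator Ω s (pointSum x c) := by
  refine ⟨fun ξ hξ => ?_, fun q hq => ?_⟩
  · obtain ⟨i, rfl⟩ := mem_range_of_mem_support_pointSum x hξ
    exact hxΩ i
  · exact (pairing_pointSum x _ c).trans (hc q hq)

/-- The error functionals of the formulas that are exact on `Π^d_s` are represented by vectors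
`e w` of the Hilbert space. -/
theorem exists_error_representer [CompleteSpace H] [FiniteDimensional ℝ (polySpace d s)]
    (hK : IsCPD Ω s K) (hJ : IsFeatureMap Ω s K J) (hz : z ∈ Ω) (ha : HasMixedPartials Ω k K z)
    (hxΩ : ∀ i, x i ∈ Ω) (hb : ∀ i, DiffOpExists Ω k a (fun y => K y (x i)) z) :
    ∃ e : (Fin N → ℝ) → H,
      (∀ w w', e w' = e w - J (pointSum x (w' - w))) ∧
      ∀ w, IsExact s k a z x w →
        (∀ f u, (∀ c, IsAnnihilator Ω s c → pairing f c = ⟪J c, u⟫) →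
          DiffOpExists Ω k a f z ∧ errFun k a z x w f = ⟪e w, u⟫) ∧
        Qform K k a z x w = ⟪e w, e w⟫ ∧
        ∀ c : Fin N → ℝ, (∀ q ∈ polySpace d s, ∑ i, c i * polyFun q (x i) = 0) →
          ⟪e w, J (pointSum x c)⟫
            = ∑ i, c i * (diffOp k a (fun y => K y (x i)) z - ∑ j, w j * K (x i) (x j)) := by
  classical
  obtain ⟨Y, n, y, p, D, hzY, hYΩ, hY, hint, hKY, hD⟩ :=
    exists_local_representer (a := a) hK hJ hz ha
  have hΩ : k = 0 ∨ Ω ∈ 𝓝 z := hY.imp_right fun h => mem_of_superset h hYΩ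
  set Dp : Fin n → ℝ := fun j => diffOp k a (polyFun (p j)) z with hDp
  -- The part of `ε_w` that consists of point values once `Df(z) = ⟪D, u⟫ + ∑ Dp_j f(y_j)`. It
  -- agrees with `ε_w` on `Π^d_s`, since the interpolation reproduces polynomials, and so
  -- annihilates them when `w` is exact.
  set μ : (Fin N → ℝ) → (EuclideanSpace ℝ (Fin d) →₀ ℝ) :=
    fun w => pointSum y Dp - pointSum x w with hμ
  have hμpair : ∀ w f, pairing f (μ w) = ∑ j, Dp j * f (y j) - ∑ i, w i * f (x i) := by
    intro w f; simp [hμ]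
  have hμsupp : ∀ w, ∀ ξ ∈ (μ w).support, ξ ∈ Y ∪ Set.range x := by
    intro w ξ hξ
    rcases Finset.mem_union.1 (Finsupp.support_sub hξ) with h1 | h1
    · obtain ⟨j, rfl⟩ := mem_range_of_mem_support_pointSum y h1
      exact Or.inl (hint.mem j)
    · exact Or.inr (mem_range_of_mem_support_pointSum x h1)
  have hsub : Y ∪ Set.range x ⊆ Ω := Set.union_subset hYΩ (Set.range_subset_iff.2 hxΩ)
  have hμA : ∀ w, IsExact s k a z x w → IsAnnihilator Ω s (μ w) := by
    intro w hw
    refine ⟨fun ξ hξ => hsub (hμsupp w ξ hξ), fun q hq => ?_⟩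
    change pairing (polyFun q) (μ w) = 0
    have h1 := diffOpExists_sum (a := a) hz hΩ Finset.univ (fun j => polyFun q (y j))
      fun j _ => diffOpExists_polyFun hz hΩ (p j)
    have h2 : diffOp k a (polyFun q) z = ∑ j, Dp j * polyFun q (y j) := by
      rw [diffOp_congr hzY hY (g := fun ξ => ∑ j, polyFun q (y j) * polyFun (p j) ξ), h1.2]
      · exact Finset.sum_congr rfl fun j _ => mul_comm _ _
      · intro ξ hξ
        rw [hint.eq_sum q hq ξ hξ]
        exact Finset.sum_congr rfl fun j _ => mul_comm _ _
    rw [hμpair, ← h2]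
    exact hw q hq
  set e : (Fin N → ℝ) → H := fun w => D + J (μ w) with he
  -- Only the functionals `λ_ξ` and `μ w` are tested. This matters for `f = ε_w''K`, whose pairing
  -- with an annihilator is controlled only for supports in `Y ∪ Set.range x`, where `D'K(z, ·)` is
  -- known to exist.
  have key : ∀ w, ∀ f u, (∀ ξ ∈ Y, pairing f (interpError y p ξ) = ⟪J (interpError y p ξ), u⟫) →
      pairing f (μ w) = ⟪J (μ w), u⟫ →
      DiffOpExists Ω k a f z ∧ errFun k a z x w f = ⟪e w, u⟫ := by
    intro w f u hf hf'
    obtain ⟨h1, h2⟩ := diffOp_eq_of_interpError hzY hYΩ hY (hD u) hf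
    refine ⟨h1, ?_⟩
    rw [errFun, h2, he, inner_add_left, ← hf', hμpair]
    ring
  have key' : ∀ w, IsExact s k a z x w → ∀ f u,
      (∀ c, IsAnnihilator Ω s c → pairing f c = ⟪J c, u⟫) →
      DiffOpExists Ω k a f z ∧ errFun k a z x w f = ⟪e w, u⟫ := fun w hw f u hf =>
    key w f u (fun ξ hξ => hf _ (hint.isAnnihilator hYΩ hξ)) (hf _ (hμA w hw))
  have hDK : ∀ ξ ∈ Y ∪ Set.range x, DiffOpExists Ω k a (fun η => K η ξ) z := by
    rintro ξ (hξ | ⟨i, rfl⟩)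
    exacts [hKY ξ hξ, hb i]
  have hsymm : ∀ w, ∀ ξ ∈ Y ∪ Set.range x,
      errFun k a z x w (fun η => K η ξ) = errFun k a z x w (fun η => K ξ η) := by
    intro w ξ hξ
    unfold errFun
    rw [diffOp_congr hzY hY fun η hη => hK.1 η (hYΩ hη) ξ (hsub hξ)]
    simp only [hK.1 _ (hxΩ _) ξ (hsub hξ)]
  -- By symmetry and linearity the left side is `ε_w` of the kernel sum with coefficients `c`, a
  -- function represented by `J c`.
  have herr : ∀ w, IsExact s k a z x w → ∀ c, IsAnnihilator Ω s c →
      (∀ ξ ∈ c.support, ξ ∈ Y ∪ Set.range x) →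
      pairing (fun ξ => errFun k a z x w fun η => K ξ η) c = ⟪J c, e w⟫ := by
    intro w hw c hc hcs
    have h1 := (key' w hw (kernelSum K c 0) (J c) fun c' hc' => by
      rw [pairing_kernelSum hc' (Submodule.zero_mem _), hJ.inner_eq _ _ hc' hc]).2
    rw [real_inner_comm, ← h1]
    have h2 : kernelSum K c 0 = fun η => ∑ ξ ∈ c.support, c ξ * K η ξ := by
      funext η; simp [kernelSum, polyFun, Finsupp.sum]
    have h3 := diffOpExists_sum (a := a) hz hΩ c.support (fun ξ => c ξ)
      (f := fun ξ η => K η ξ) fun ξ hξ => hDK ξ (hcs ξ hξ)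
    rw [h2, errFun, h3.2, pairing_apply]
    simp only [Finset.mul_sum]
    rw [Finset.sum_comm, ← Finset.sum_sub_distrib]
    refine Finset.sum_congr rfl fun ξ hξ => ?_
    rw [← hsymm w ξ (hcs ξ hξ), errFun, mul_sub, Finset.mul_sum]
    congr 1
    exact Finset.sum_congr rfl fun j _ => by ring
  refine ⟨e, fun w w' => ?_, fun w hw => ⟨key' w hw, ?_, fun c hc => ?_⟩⟩
  · simp only [he, hμ, map_sub]
    abel
  -- By `herr`, the function `ξ ↦ ε_w''K(ξ, ·)` is represented by `e w` itself; applying `ε_w` to it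
  -- gives `Q(w)`.
  · exact (key w _ (e w)
      (fun ξ hξ => herr w hw _ (hint.isAnnihilator hYΩ hξ)
        fun η hη => Or.inl (hint.support_interpError hξ η hη))
      (herr w hw _ (hμA w hw) (hμsupp w))).2
  · rw [real_inner_comm, ← herr w hw _ (isAnnihilator_pointSum hxΩ hc)
      fun ξ hξ => Or.inr (mem_range_of_mem_support_pointSum x hξ), pairing_pointSum]
    refine Finset.sum_congr rfl fun i _ => ?_
    rw [← hsymm w _ (Or.inr ⟨i, rfl⟩), errFun]
    simp only [hK.1 _ (hxΩ i) _ (hxΩ _)]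

end LocalRep

/-! ### Exact weights, Lagrange multipliers and worst case errors -/

section Optimal

variable {d s k N M : ℕ} {Ω : Set (EuclideanSpace ℝ (Fin d))}
  {K : EuclideanSpace ℝ (Fin d) → EuclideanSpace ℝ (Fin d) → ℝ}
  {a : (Fin d → ℕ) → EuclideanSpace ℝ (Fin d) → ℝ} {z : EuclideanSpace ℝ (Fin d)}
  {x : Fin N → EuclideanSpace ℝ (Fin d)}
  {H : Type*} [NormedAddCommGroup H] [InnerProductSpace ℝ H]
  {J : (EuclideanSpace ℝ (Fin d) →₀ ℝ) →ₗ[ℝ] H}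

/-- The coefficient vectors `c` with `∑ c_i q(x_i) = 0` for all `q ∈ Π^d_s`. -/
def momentKernel (s : ℕ) (x : Fin N → EuclideanSpace ℝ (Fin d)) : Submodule ℝ (Fin N → ℝ) where
  carrier := {c | ∀ q ∈ polySpace d s, ∑ i, c i * polyFun q (x i) = 0}
  zero_mem' := by simp
  add_mem' hb hc q hq := by
    simp only [Pi.add_apply, add_mul, Finset.sum_add_distrib, hb q hq, hc q hq, add_zero]
  smul_mem' r c hc q hq := by
    simp only [Pi.smul_apply, smul_eq_mul, mul_assoc, ← Finset.mul_sum, hc q hq, mul_zero]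

theorem isExact_iff_polyEqs (p : Module.Basis (Fin M) ℝ (polySpace d s)) (hz : z ∈ Ω)
    (hΩ : k = 0 ∨ Ω ∈ 𝓝 z) {w : Fin N → ℝ} :
    IsExact s k a z x w ↔
      PolyEqs k a z x (fun i => (p i : MvPolynomial (Fin d) ℝ)) w := by
  refine ⟨fun h i => (sub_eq_zero.1 (h (p i) (p i).2)).symm, fun h q hq => ?_⟩
  have hex := fun q => diffOpExists_polyFun (a := a) hz hΩ q
  let T : polySpace d s →ₗ[ℝ] ℝ :=
    { toFun := fun q => errFun k a z x w (polyFun q)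
      map_add' := fun q r => by
        have h1 := ((hex q).lin 1 1 (hex r)).2
        have h2 : polyFun (q + r : polySpace d s).1 =
            fun y => 1 * polyFun q.1 y + 1 * polyFun r.1 y := by
          funext y; rw [one_mul, one_mul]; exact polyFun_add _ _ _
        simp only [errFun]
        rw [h2, h1]
        simp only [one_mul, mul_add, Finset.sum_add_distrib]
        ring
      map_smul' := fun c q => by
        have h1 := ((hex q).lin c 0 (hex q)).2
        have h2 : polyFun (c • q : polySpace d s).1 =
            fun y => c * polyFun q.1 y + 0 * polyFun q.1 y := by
          funext y; rw [zero_mul, add_zero]; exact polyFun_smul _ _ _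
        simp only [errFun]
        rw [h2, h1]
        simp only [zero_mul, add_zero, RingHom.id_apply, smul_eq_mul, mul_sub, Finset.mul_sum]
        congr 1
        exact Finset.sum_congr rfl fun j _ => by ring }
  have hT : T = 0 := p.ext fun i => sub_eq_zero.2 (h i).symm
  exact LinearMap.congr_fun hT ⟨q, hq⟩

theorem mem_momentKernel_of_basis (p : Module.Basis (Fin M) ℝ (polySpace d s)) {c : Fin N → ℝ}
    (h : ∀ j, ∑ i, c i * polyFun (p j) (x i) = 0) : c ∈ momentKernel s x := by
  have hT : ∑ i, c i • polyEval d s (x i) = 0 := p.ext fun j => by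
    simpa [LinearMap.sum_apply, polyEval] using h j
  intro q hq
  simpa [LinearMap.sum_apply, polyEval] using LinearMap.congr_fun hT ⟨q, hq⟩

theorem IsExact.sub_mem_momentKernel {w w' : Fin N → ℝ} (h : IsExact s k a z x w)
    (h' : IsExact s k a z x w') : w' - w ∈ momentKernel s x := by
  intro q hq
  have h1 := h q hq
  have h2 := h' q hq
  simp only [errFun] at h1 h2
  simp only [Pi.sub_apply, sub_mul, Finset.sum_sub_distrib]
  linarith

theorem IsExact.add_mem_momentKernel {w c : Fin N → ℝ} (h : IsExact s k a z x w)
    (hc : c ∈ momentKernel s x) : IsExact s k a z x (w + c) := by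
  intro q hq
  have h1 := h q hq
  have h2 := hc q hq
  simp only [errFun] at h1 ⊢
  simp only [Pi.add_apply, add_mul, Finset.sum_add_distrib, h2, add_zero, h1]

/-- A functional vanishing on the common kernel of finitely many functionals is in their span; the
coefficients `v` are the Lagrange multipliers of the moment conditions. -/
theorem exists_eq_sum_of_orthogonal (p : Module.Basis (Fin M) ℝ (polySpace d s)) {r : Fin N → ℝ} :
    (∀ c ∈ momentKernel s x, ∑ i, c i * r i = 0) ↔
      ∃ v : Fin M → ℝ, ∀ i, ∑ j, v j * polyFun (p j) (x i) = r i := by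
  constructor
  · intro h
    let L : (Fin N → ℝ) → ((Fin N → ℝ) →ₗ[ℝ] ℝ) := fun b =>
      ∑ i, b i • (LinearMap.proj i : (Fin N → ℝ) →ₗ[ℝ] ℝ)
    have hL : ∀ b c, L b c = ∑ i, c i * b i := by
      intro b c
      simp [L, LinearMap.sum_apply, mul_comm]
    have h1 := mem_span_of_iInf_ker_le_ker (L := fun j => L fun i => polyFun (p j) (x i))
      (K := L r) fun c hc => by
        rw [LinearMap.mem_ker, hL]
        refine h c (mem_momentKernel_of_basis p fun j => ?_)
        rw [← hL]
        exact (Submodule.mem_iInf _).1 hc j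
    obtain ⟨v, hv⟩ := (Submodule.mem_span_range_iff_exists_fun ℝ).1 h1
    refine ⟨v, fun i => ?_⟩
    have h2 := LinearMap.congr_fun hv (Pi.single i 1)
    simpa [LinearMap.sum_apply, hL, Pi.single_apply] using h2
  · rintro ⟨v, hv⟩ c hc
    simp only [← hv, Finset.mul_sum]
    rw [Finset.sum_comm]
    refine Finset.sum_eq_zero fun j _ => ?_
    have := hc (p j) (p j).2
    calc ∑ i, c i * (v j * polyFun (p j) (x i)) = v j * ∑ i, c i * polyFun (p j) (x i) := by
          rw [Finset.mul_sum]; exact Finset.sum_congr rfl fun i _ => by ring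
      _ = 0 := by rw [this, mul_zero]

theorem IsFeatureMap.eq_zero_of_momentKernel (hK : IsCPD Ω s K) (hJ : IsFeatureMap Ω s K J)
    (hx : Function.Injective x) (hxΩ : ∀ i, x i ∈ Ω) {c : Fin N → ℝ} (hc : c ∈ momentKernel s x)
    (h : J (pointSum x c) = 0) : c = 0 := by
  have hA := isAnnihilator_pointSum hxΩ hc
  refine pointSum_injective hx ?_
  rw [map_zero]
  by_contra h0
  have h1 := hK.2 _ hA h0
  rw [energy_eq_kernelForm, ← hJ.inner_eq _ _ hA hA, h, inner_zero_left] at h1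
  exact h1.false

/-- The worst case error over the unit ball of a functional represented by `u₀` is `‖u₀‖`. -/
theorem IsFeatureMap.isLUB_unitBallErrors [CompleteSpace H] (hJ : IsFeatureMap Ω s K J)
    {w : Fin N → ℝ} {u₀ : H}
    (h : ∀ f u, (∀ c, IsAnnihilator Ω s c → pairing f c = ⟪J c, u⟫) →
      errFun k a z x w f = ⟪u₀, u⟫) :
    IsLUB (unitBallErrors Ω s K k a z x w) ‖u₀‖ := by
  constructor
  · rintro _ ⟨f, hf, hf1, rfl⟩
    obtain ⟨u, hu, hfu⟩ := hJ.exists_of_mem_nativeSpace hf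
    rw [h f u hfu]
    refine (abs_real_inner_le_norm _ _).trans ?_
    rw [← hu]
    exact mul_le_of_le_one_right (norm_nonneg _) hf1
  · intro t ht
    -- The test functions are the kernel sums, represented by `J c`. The vector `u₀` is only a limit
    -- of such `J c`, so the bound is made homogeneous and extended by density.
    have hA : ∀ c, IsAnnihilator Ω s c → ‖J c‖ ≤ 1 → |⟪u₀, J c⟫| ≤ t := by
      intro c hc hc1
      have hfu : ∀ c', IsAnnihilator Ω s c' → pairing (kernelSum K c 0) c' = ⟪J c', J c⟫ :=
        fun c' hc' => by
          rw [pairing_kernelSum hc' (Submodule.zero_mem _), hJ.inner_eq _ _ hc' hc]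
      have hmem := kernelSum_mem_nativeSpace (K := K) hc
      refine ht ⟨kernelSum K c 0, hmem, ?_, by rw [h _ _ hfu]⟩
      obtain ⟨u, hu, hu'⟩ := hJ.exists_of_mem_nativeSpace hmem
      have : u = J c := hJ.ext fun c' hc' => by rw [← hu' c' hc', hfu c' hc']
      rwa [hu, this]
    have ht0 : 0 ≤ t := by
      simpa using hA 0 (annihilators Ω s).zero_mem (by simp)
    have hB : ∀ c, IsAnnihilator Ω s c → ⟪u₀, J c⟫ ≤ t * ‖J c‖ := by
      intro c hc
      rcases eq_or_ne ‖J c‖ 0 with h0 | h0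
      · rw [norm_eq_zero.1 h0]; simp
      · have h1 := hA (‖J c‖⁻¹ • c) ((annihilators Ω s).smul_mem _ hc) (by
          rw [map_smul, norm_smul, norm_inv, norm_norm, inv_mul_cancel₀ h0])
        rw [map_smul, inner_smul_right, abs_mul, abs_inv, abs_norm] at h1
        have h2 := le_abs_self ⟪u₀, J c⟫
        rw [inv_mul_le_iff₀ (by positivity)] at h1
        linarith
    have hcl : IsClosed {u : H | ⟪u₀, u⟫ ≤ t * ‖u‖} :=
      isClosed_le (by fun_prop) (by fun_prop)
    have h1 : ⟪u₀, u₀⟫ ≤ t * ‖u₀‖ := hcl.closure_subset_iff.2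
      (by rintro _ ⟨c, hc, rfl⟩; exact hB c hc) (hJ.dense u₀)
    rw [real_inner_self_eq_norm_mul_norm] at h1
    rcases eq_or_ne u₀ 0 with h0 | h0
    · rwa [h0, norm_zero]
    · exact le_of_mul_le_mul_right h1 (norm_pos_iff.2 h0)

theorem isLUB_sq {S : Set ℝ} (hS : ∀ e ∈ S, 0 ≤ e) {b : ℝ} (hb : 0 ≤ b) (h : IsLUB S b) :
    IsLUB {t | ∃ e ∈ S, t = e ^ 2} (b ^ 2) := by
  constructor
  · rintro _ ⟨e, he, rfl⟩
    exact pow_le_pow_left₀ (hS e he) (h.1 he) 2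
  · intro t ht
    -- The empty set has no least upper bound in `ℝ`, so some error exists and forces `0 ≤ t`.
    obtain ⟨e₀, he₀⟩ := h.nonempty
    have ht0 : 0 ≤ t := (sq_nonneg e₀).trans (ht ⟨e₀, he₀, rfl⟩)
    exact (Real.le_sqrt hb ht0).1 (h.2 fun e he => Real.le_sqrt_of_sq_le (ht ⟨e, he, rfl⟩))

end Optimal

end KernelDiff

/-! ### Optimal recovery by orthogonal projection -/

open KernelDiff in
theorem proposition3 {d N M : ℕ} (s k : ℕ)
    (Ω : Set (EuclideanSpace ℝ (Fin d)))
    (K : EuclideanSpace ℝ (Fin d) → EuclideanSpace ℝ (Fin d) → ℝ)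
    (hK : IsCPD Ω s K)
    (a : (Fin d → ℕ) → EuclideanSpace ℝ (Fin d) → ℝ)
    (p : Module.Basis (Fin M) ℝ (polySpace d s))
    (z : EuclideanSpace ℝ (Fin d)) (hz : z ∈ Ω)
    (x : Fin N → EuclideanSpace ℝ (Fin d)) (hx : Function.Injective x) (hxΩ : ∀ i, x i ∈ Ω)
    (ha : HasMixedPartials Ω k K z)
    (hb : ∀ i, DiffOpExists Ω k a (fun y => K y (x i)) z)
    (hc : ∃ w : Fin N → ℝ, PolyEqs k a z x (fun i => (p i : MvPolynomial (Fin d) ℝ)) w) :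
    ∃ wstar : Fin N → ℝ,
      -- `wstar` is the unique weight vector determined by the linear system
      (∀ w : Fin N → ℝ,
        (∃ v : Fin M → ℝ, KernelEqs K k a z x (fun i => (p i : MvPolynomial (Fin d) ℝ)) w v ∧
          PolyEqs k a z x (fun i => (p i : MvPolynomial (Fin d) ℝ)) w) ↔ w = wstar) ∧
      -- the error bound
      (∀ f ∈ nativeSpace Ω s K, DiffOpExists Ω k a f z ∧
        |diffOp k a f z - ∑ j, wstar j * f (x j)|
          ≤ powerFun s K k a z x * nativeNorm Ω s K f) ∧
      -- the squared power function is the minimum of `Q` over the exact weights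
      IsLeast {t | ∃ w : Fin N → ℝ, IsExact s k a z x w ∧ t = Qform K k a z x w}
        (powerFun s K k a z x ^ 2) ∧
      -- `Q(w)` is the squared worst case error of an exact formula on the unit ball
      (∀ w : Fin N → ℝ, IsExact s k a z x w →
        IsLUB {t | ∃ e ∈ unitBallErrors Ω s K k a z x w, t = e ^ 2} (Qform K k a z x w)) ∧
      -- optimal recovery: `wstar` is exact and attains the least worst case error, which is `P`
      IsExact s k a z x wstar ∧ Qform K k a z x wstar = powerFun s K k a z x ^ 2 ∧
      IsLUB (unitBallErrors Ω s K k a z x wstar) (powerFun s K k a z x) ∧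
      IsLeast {r | ∃ w : Fin N → ℝ, IsExact s k a z x w ∧
        IsLUB (unitBallErrors Ω s K k a z x w) r} (powerFun s K k a z x) := by
  have hfin : FiniteDimensional ℝ (polySpace d s) := Module.Finite.of_basis p
  obtain ⟨H, _, _, _, J, hJ⟩ := exists_isFeatureMap hK
  obtain ⟨e, he, hrep⟩ := exists_error_representer hK hJ hz ha hxΩ hb
  have hΩ : k = 0 ∨ Ω ∈ 𝓝 z := (eq_or_ne k 0).imp_right (ha.mem_nhds hz)
  obtain ⟨w₀, hw₀⟩ := hc
  have hw₀ := (isExact_iff_polyEqs p hz hΩ).2 hw₀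
  -- Adding `c` to the weights subtracts `J (pointSum x c)` from the representer, so the projection
  -- coefficients `c₀` correct `w₀` to weights whose representer is orthogonal to all admissible
  -- changes.
  obtain ⟨_, ⟨c₀, hc₀, rfl⟩, u, hu, hsum⟩ :=
    ((momentKernel s x).map (J ∘ₗ pointSum x)).exists_add_mem_mem_orthogonal (e w₀)
  set w' := w₀ + c₀ with hw'
  have hex : IsExact s k a z x w' := hw₀.add_mem_momentKernel hc₀
  have heu : e w' = u := by
    rw [he w₀ w', hsum, hw', add_sub_cancel_left, LinearMap.comp_apply, add_sub_cancel_left]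
  have horth : ∀ c ∈ momentKernel s x, inner ℝ (e w') (J (pointSum x c)) = 0 := fun c hc => by
    rw [heu, real_inner_comm]
    exact hu _ ⟨c, hc, rfl⟩
  have hmin : ∀ w, IsExact s k a z x w → ‖e w'‖ ≤ ‖e w‖ := fun w hw => by
    have h1 := norm_sub_sq_real (e w') (J (pointSum x (w - w')))
    rw [← he w' w, horth _ (hex.sub_mem_momentKernel hw)] at h1
    refine le_of_sq_le_sq ?_ (norm_nonneg _)
    nlinarith [sq_nonneg ‖J (pointSum x (w - w'))‖]
  have hQ : ∀ w, IsExact s k a z x w → Qform K k a z x w = ‖e w‖ ^ 2 := fun w hw => by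
    rw [(hrep w hw).2.1, real_inner_self_eq_norm_sq]
  have hleast : IsLeast {t | ∃ w : Fin N → ℝ, IsExact s k a z x w ∧ t = Qform K k a z x w}
      (‖e w'‖ ^ 2) := by
    refine ⟨⟨w', hex, (hQ w' hex).symm⟩, ?_⟩
    rintro _ ⟨w, hw, rfl⟩
    rw [hQ w hw]
    exact pow_le_pow_left₀ (norm_nonneg _) (hmin w hw) 2
  have hP : powerFun s K k a z x = ‖e w'‖ := by
    rw [powerFun, hleast.csInf_eq, Real.sqrt_sq (norm_nonneg _)]
  have hlub : ∀ w, IsExact s k a z x w → IsLUB (unitBallErrors Ω s K k a z x w) ‖e w‖ :=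
    fun w hw => hJ.isLUB_unitBallErrors fun f u hf => ((hrep w hw).1 f u hf).2
  rw [hP]
  refine ⟨w', fun w => ?_, fun f hf => ?_, hleast, fun w hw => ?_, hex, hQ w' hex, hlub w' hex,
    ⟨w', hex, hlub w' hex⟩, ?_⟩
  · have hker : ∀ v, KernelEqs K k a z x (fun i => (p i : MvPolynomial (Fin d) ℝ)) w v ↔
        ∀ i, ∑ j, v j * polyFun (p j) (x i)
          = diffOp k a (fun y => K y (x i)) z - ∑ j, w j * K (x i) (x j) := fun v =>
      forall_congr' fun i => by rw [eq_sub_iff_add_eq']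
    -- The kernel equations are solvable in `v` if and only if their residual is orthogonal to
    -- `momentKernel s x`. For exact `w` this says that `e w` is orthogonal to every `J (pointSum x
    -- c)`.
    simp only [exists_and_right, hker, ← isExact_iff_polyEqs p hz hΩ,
      ← exists_eq_sum_of_orthogonal p]
    constructor
    · rintro ⟨h1, hw⟩
      -- Both `e w` and `e w'` are orthogonal to their difference `J (pointSum x (w - w'))` up to
      -- sign, which therefore vanishes.
      have hmem := hex.sub_mem_momentKernel hw
      have h2 := (hrep w hw).2.2 _ hmem
      rw [h1 _ hmem, he w' w, inner_sub_left, horth _ hmem, zero_sub, neg_eq_zero,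
        inner_self_eq_zero] at h2
      exact sub_eq_zero.1 (hJ.eq_zero_of_momentKernel hK hx hxΩ hmem h2)
    · rintro rfl
      exact ⟨fun c hc => by rw [← (hrep w' hex).2.2 c hc, horth c hc], hex⟩
  · obtain ⟨u, hu, hfu⟩ := hJ.exists_of_mem_nativeSpace hf
    obtain ⟨h1, h2⟩ := (hrep w' hex).1 f u hfu
    refine ⟨h1, ?_⟩
    change |errFun k a z x w' f| ≤ _
    rw [h2, hu]
    exact abs_real_inner_le_norm _ _
  · rw [hQ w hw]
    refine isLUB_sq ?_ (norm_nonneg _) (hlub w hw)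
    rintro _ ⟨f, -, -, rfl⟩
    exact abs_nonneg _
  · rintro r ⟨w, hw, hr⟩
    rw [hr.unique (hlub w hw)]
    exact hmin w hw
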